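/- Consider the deterministic $\mathsf{LOCAL}$ model of distributed computing on a finite simple graph $G=(V,E)$ with $n=|V|$ nodes and maximum degree $\Delta$. Nodes have unique identifiers from $\{0,\dots,N-1\}$, where $N\le n^{c}$ for a constant $c$, and each node numbers its incident edges by ports in an arbitrary way. In each synchronous round, each node may send a message of arbitrary size to each of its neighbors. Local computation is unlimited. At the start a node knows its own identifier, its degree, $\varepsilon$, $N$, and a number $L$ that equals $\log_2\Delta$ up to a constant factor, that is, $\frac1k\log_2\Delta\le L\le k\log_2\Delta$ for a constant $k\ge 1$ (where $\log_2 0$ is read as $0$ if $G$ has no edges). Let $\log^* n$ be the number of times that $\log_2$ has to be applied to $n$ until the value is at most $1$ (and $\log^* 0=0$). **Theorem.** For all constants $c\in\mathbb N$ and $k\ge1$ there are a deterministic $\mathsf{LOCAL}$ algorithm and a constant $C$, which depend only on $c$ and $k$, such that for every $\varepsilon>0$ and every such network the algorithm terminates at all nodes within $$C\cdot\Bigl(\log_2^2\Delta\cdot\max\bigl\{1,\log_2\tfrac1\varepsilon\bigr\}+\log^* n\Bigr)$$ rounds and computes a $(2+\varepsilon)$-approximate maximum matching of $G$, that is, a matching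 $M\subseteq E$ with $(2+\varepsilon)\,|M|\ge|M^*|$ for a maximum matching $M^*$ of $G$. Here each node outputs either the port of its incident edge in $M$ or that it is unmatched. -/

import Mathlib

/-- The iterated logarithm `log* x`: how often `log₂` has to be applied to `x` until the value
is at most `1`. -/
noncomputable def logStar (x : ℝ) : ℕ :=
  sInf {k : ℕ | (Real.logb 2)^[k] x ≤ 1}

/-- The set in the definition of `logStar` is never empty, so `logStar` takes no junk value. -/
theorem logStar_set_nonempty (x : ℝ) : {k : ℕ | (Real.logb 2)^[k] x ≤ 1}.Nonempty := by
  have key : ∀ (m : ℕ) (y : ℝ), y ≤ m → ∃ k : ℕ, (Real.logb 2)^[k] y ≤ 1 := by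
    intro m
    induction m with
    | zero =>
      intro y hy
      exact ⟨0, by simp only [Function.iterate_zero, id]; push_cast at hy; linarith⟩
    | succ m ih =>
      intro y hy
      by_cases h1 : y ≤ 1
      · exact ⟨0, by simpa using h1⟩
      · have hy0 : 0 < y := by linarith [not_le.mp h1]
        have h2 : Real.logb 2 y ≤ (m : ℝ) := by
          rw [Real.logb_le_iff_le_rpow (by norm_num) hy0, Real.rpow_natCast]
          have h3 : m + 1 ≤ 2 ^ m := Nat.lt_two_pow_self
          calc y ≤ ((m + 1 : ℕ) : ℝ) := hy
            _ ≤ ((2 ^ m : ℕ) : ℝ) := by exact_mod_cast h3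
            _ = 2 ^ m := by push_cast; rfl
        obtain ⟨k, hk⟩ := ih _ h2
        exact ⟨k + 1, by simpa [Function.iterate_succ_apply] using hk⟩
  exact key ⌈x⌉₊ x (Nat.le_ceil x)

/-- A communication network on the graph `G`: every node carries a unique identifier, and every
node numbers its incident edges by ports in an arbitrary way. -/
structure Network {V : Type*} [Fintype V] (G : SimpleGraph V) [DecidableRel G.Adj] where
  /-- the identifier of a node -/
  id : V → ℕ
  id_injective : Function.Injective id
  /-- the neighbor at the other end of a port -/
  port : ∀ v : V, Fin (G.degree v) ≃ G.neighborSet v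

namespace Network

variable {V : Type*} [Fintype V] {G : SimpleGraph V} [DecidableRel G.Adj]

/-- The neighbor of `v` behind its port `p`. -/
def nbr (net : Network G) (v : V) (p : Fin (G.degree v)) : V := (net.port v p : V)

/-- The port of the neighbor `net.nbr v p` that leads back to `v`. -/
def backPort (net : Network G) (v : V) (p : Fin (G.degree v)) :
    Fin (G.degree (net.nbr v p)) :=
  (net.port (net.nbr v p)).symm ⟨v, G.adj_symm (net.port v p).2⟩

end Network

/-- A deterministic algorithm in the `LOCAL` model. Here `K` is the type of the knowledge that is
common to all nodes, and `Out d` is the type of the possible outputs of a node of degree `d`.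
At the start a node knows only the common knowledge, its own identifier, and its degree.
Neither the messages nor the local computations are limited. -/
structure LocalAlgorithm (K : Type) (Out : ℕ → Type) where
  /-- local states -/
  State : Type
  /-- messages -/
  Msg : Type
  /-- the initial state, from the common knowledge, the identifier, and the degree -/
  init : K → ℕ → ℕ → State
  /-- the message that is sent through each port -/
  send : (d : ℕ) → State → Fin d → Msg
  /-- the new state, from the old one and the messages received through the ports -/
  recv : (d : ℕ) → State → (Fin d → Msg) → State
  /-- the output; `none` as long as the node has not terminated -/
  output : (d : ℕ) → State → Option (Out d)

namespace LocalAlgorithm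

variable {K : Type} {Out : ℕ → Type} {V : Type*} [Fintype V] {G : SimpleGraph V}
  [DecidableRel G.Adj]

/-- The state of each node after a number of synchronous rounds. A node that has terminated keeps
its state, so that its output is irrevocable. -/
def state (A : LocalAlgorithm K Out) (net : Network G) (κ : K) : ℕ → V → A.State
  | 0, v => A.init κ (net.id v) (G.degree v)
  | t + 1, v =>
    if (A.output (G.degree v) (A.state net κ t v)).isSome then A.state net κ t v
    else A.recv (G.degree v) (A.state net κ t v) fun p =>
      A.send (G.degree (net.nbr v p)) (A.state net κ t (net.nbr v p)) (net.backPort v p)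

/-- Within `T` rounds every node `v` terminates, with output `out v`. -/
def TerminatesWithin (A : LocalAlgorithm K Out) (net : Network G) (κ : K) (T : ℕ)
    (out : ∀ v : V, Out (G.degree v)) : Prop :=
  ∀ v : V, A.output (G.degree v) (A.state net κ T v) = some (out v)

end LocalAlgorithm

/-- What is known to all nodes in advance. -/
structure Knowledge where
  /-- a bound on the identifiers -/
  idBound : ℕ
  /-- an estimate of the logarithm of the maximum degree -/
  logDegree : ℝ
  /-- the accuracy parameter -/
  eps : ℝ

/-- The output of a node of degree `d` in a matching algorithm: the port of its matching edge, or
`none` if the node is unmatched. -/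
abbrev MatchOutput (d : ℕ) : Type := Option (Fin d)

/-- The outputs of the nodes describe the edges of `M`: an edge `{v, w}` belongs to `M` exactly
if `v` outputs its port to `w` (so, as `M` is undirected, exactly if `w` outputs its port
to `v`). -/
def Network.Describes {V : Type*} [Fintype V] {G : SimpleGraph V} [DecidableRel G.Adj]
    (net : Network G) (out : ∀ v : V, MatchOutput (G.degree v)) (M : G.Subgraph) : Prop :=
  ∀ v w : V, M.Adj v w ↔ ∃ p : Fin (G.degree v), out v = some p ∧ net.nbr v p = w

/-- A maximum matching: a matching with the largest number of edges. -/
def IsMaximumMatching {V : Type*} {G : SimpleGraph V} (M : G.Subgraph) : Prop :=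
  M.IsMatching ∧ ∀ M' : G.Subgraph, M'.IsMatching → M'.edgeSet.ncard ≤ M.edgeSet.ncard

/-- A `c`-approximate maximum matching: a matching `M` with `c |M| ≥ |M*|` for a maximum
matching `M*`. -/
def IsApproxMaximumMatching {V : Type*} {G : SimpleGraph V} (c : ℝ) (M : G.Subgraph) : Prop :=
  M.IsMatching ∧ ∀ Mstar : G.Subgraph, IsMaximumMatching Mstar →
    (Mstar.edgeSet.ncard : ℝ) ≤ c * (M.edgeSet.ncard : ℝ)

/-! The matching is obtained by rounding a fractional matching. Every edge is directed to its
endpoint of larger identifier, and a vertex has separate capacities `2 ^ h ≥ Δ` for its outgoing and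
its incoming edges, so the fractional problem is bipartite. Weight `1` everywhere is feasible.
Doubling `h` times the edges that have no half-full end leaves every edge with a half-full end, so
the total weight is at least `2 ^ h / 4` times the size of any matching
(`card_le_totalWeight_growWeights`).

A rounding step eliminates the weight `2 ^ i`. The edges of this weight are paired at tails and at
heads, which forms paths and cycles, and ideally every second edge is doubled and the rest dropped.
Exact alternation is not local, so each edge looks only `r` steps both ways and is oriented towards
the larger label. Consistent orientation means alternation, and two orientations face each other
only at labels that are maximal within distance `r`. These are rare, and the loss is a fraction of
at most `2 / (r + 1)` (`card_le_splitKeep`). With `r + 1 = 4 * h`, all `h` steps together keep half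
of the weight (`totalWeight_roundWeights`).

The edges that end with weight `2 ^ h` form directed paths. One Cole–Vishkin step on their labels
gives `O(h)` classes, and taking the classes greedily gives a maximal matching of the paths. It
loses a factor of at most `4 * 2 * 4 = 32` altogether (`card_le_constMatching`).

This is iterated on the edges that are not yet touched. A matching of the rest joined with the one
just found is a matching of the previous graph, so the largest remaining matching shrinks by `31 /
32` each time. Since `M` touches at most `2 * |M|` edges of a maximum matching, `O(max 1 (log (1 /
ε)))` iterations give the factor `2 + ε` (`card_le_iterMatching`).

An iteration has radius `O(h ^ 2)`. The labels are computed once, by `log* N` color reductions in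
forests. All phases are plain functions of the graph whose values depend only on a ball
(`edgeAgree_graphMatching`); the nodes collect this ball (`agree_knownGraph`) and evaluate the
functions on it. -/

/-! ### Local orientation of paths and cycles, and the sparsity of its sinks -/

section Walk

variable {Φ : Type*} (τ ι : Φ → Φ)

/-- `SegWalk τ ι k x y`: `k` applications of `τ` lead from `x` to `y`, none of them
starting at an end, that is, at a point where `τ` and `ι` agree. -/
def SegWalk : ℕ → Φ → Φ → Prop
  | 0, x, y => x = y
  | k + 1, x, y => τ x ≠ ι x ∧ SegWalk k (τ x) y

variable {τ ι}

theorem SegWalk.iterate_eq {k : ℕ} {x y : Φ} (h : SegWalk τ ι k x y) : τ^[k] x = y := by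
  induction k generalizing x with
  | zero => exact h
  | succ k ih => exact ih h.2

theorem SegWalk.append {k l : ℕ} {x y z : Φ} (h : SegWalk τ ι k x y) (h' : SegWalk τ ι l y z) :
    SegWalk τ ι (k + l) x z := by
  induction k generalizing x with
  | zero => cases h; simpa using h'
  | succ k ih => rw [Nat.succ_add]; exact ⟨h.1, ih h.2⟩

theorem SegWalk.snoc {k : ℕ} {x y : Φ} (h : SegWalk τ ι k x y) (hy : τ y ≠ ι y) :
    SegWalk τ ι (k + 1) x (τ y) :=
  h.append (show SegWalk τ ι 1 y (τ y) from ⟨hy, rfl⟩)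

theorem SegWalk.split {k l : ℕ} {x z : Φ} (h : SegWalk τ ι (k + l) x z) :
    ∃ y, SegWalk τ ι k x y ∧ SegWalk τ ι l y z := by
  induction k generalizing x with
  | zero => exact ⟨x, rfl, by simpa using h⟩
  | succ k ih =>
    rw [Nat.succ_add] at h
    obtain ⟨y, h1, h2⟩ := ih h.2
    exact ⟨y, ⟨h.1, h1⟩, h2⟩

theorem SegWalk.reverse (hι : ∀ x, ι (ι x) = x) (hτ : ∀ x, τ (ι (τ x)) = ι x) {k : ℕ} {x y : Φ}
    (h : SegWalk τ ι k x y) : SegWalk τ ι k (ι y) (ι x) := by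
  induction k generalizing x with
  | zero => cases h; rfl
  | succ k ih =>
    have h1 := (ih h.2).snoc (by rw [hτ, hι]; exact h.1.symm)
    rwa [hτ] at h1

theorem SegWalk.cancel (hinj : Function.Injective τ) {k s : ℕ} {x x' z : Φ}
    (h : SegWalk τ ι k x z) (h' : SegWalk τ ι (s + k) x' z) : SegWalk τ ι s x' x := by
  obtain ⟨y, h1, h2⟩ := h'.split
  have : y = x := hinj.iterate k (h2.iterate_eq.trans h.iterate_eq.symm)
  rwa [this] at h1

/-- Removing the first and the last step leaves a walk of the same kind, two steps shorter. Length
`0` contradicts `hne`, and length `1` would start at an end. -/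
theorem not_segWalk_flip (hι : ∀ x, ι (ι x) = x) (hne : ∀ x, ι x ≠ x)
    (hτ : ∀ x, τ (ι (τ x)) = ι x) (n : ℕ) : ∀ x, ¬ SegWalk τ ι n (ι x) x := by
  induction n using Nat.strong_induction_on with
  | _ n ih =>
    intro x h
    match n, h, ih with
    | 0, h, _ => exact hne x h
    | 1, h, _ => exact h.1 (by rw [hι]; exact h.2)
    | n + 2, h, ih =>
      obtain ⟨z, h1, h2⟩ := SegWalk.split (k := n) (l := 1) h.2
      have hz : τ z = x := h2.2
      rw [← hz, hτ] at h1
      exact ih n (by omega) z h1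

variable {β : Type*} [LinearOrder β]

open Classical in
/-- The largest label among the points reached from `x` by walks of length at most `n`. -/
noncomputable def segMax (τ ι : Φ → Φ) (lab : Φ → β) : ℕ → Φ → β
  | 0, x => lab x
  | n + 1, x => if τ x = ι x then lab x else max (lab x) (segMax τ ι lab n (τ x))

variable {lab : Φ → β}

theorem exists_segWalk_segMax (n : ℕ) (x : Φ) :
    ∃ k ≤ n, ∃ y, SegWalk τ ι k x y ∧ segMax τ ι lab n x = lab y := by
  induction n generalizing x with
  | zero => exact ⟨0, le_rfl, x, rfl, rfl⟩
  | succ n ih =>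
    by_cases hx : τ x = ι x
    · exact ⟨0, by omega, x, rfl, by simp [segMax, hx]⟩
    · rcases le_total (lab x) (segMax τ ι lab n (τ x)) with h | h
      · obtain ⟨k, hk, y, h1, h2⟩ := ih (τ x)
        exact ⟨k + 1, by omega, y, ⟨hx, h1⟩, by
          rw [segMax, if_neg hx, max_eq_right h, h2]⟩
      · exact ⟨0, by omega, x, rfl, by
          rw [segMax, if_neg hx, max_eq_left h]⟩

theorem SegWalk.lab_le_segMax {k n : ℕ} {x y : Φ} (h : SegWalk τ ι k x y) (hk : k ≤ n) :
    lab y ≤ segMax τ ι lab n x := by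
  induction n generalizing k x with
  | zero =>
    obtain rfl : k = 0 := by omega
    cases h; exact le_rfl
  | succ n ih =>
    cases k with
    | zero =>
      cases h
      rw [segMax]
      split_ifs
      · exact le_rfl
      · exact le_max_left _ _
    | succ k =>
      simp only [segMax, if_neg h.1]
      exact (ih h.2 (by omega)).trans (le_max_right _ _)

/-- The conditions on a permutation `τ` and a reversal `ι` of the flags, and on their labels. -/
structure FlagSystem (τ ι : Φ → Φ) (lab : Φ → β) (b : Φ → ℕ) : Prop where
  invol : ∀ x, ι (ι x) = x
  ne : ∀ x, ι x ≠ x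
  conj : ∀ x, τ (ι (τ x)) = ι x
  lab_inj : Function.Injective lab
  base_inj : ∀ x y, b x = b y → y = x ∨ y = ι x
  base_flip : ∀ x, b (ι x) = b x
  base_le : ∀ x y, τ y ≠ ι y → lab x ≤ lab y → b x ≤ b y

/-- A flag is forward if it sees a larger label than its reversal. -/
def IsForward (τ ι : Φ → Φ) (lab : Φ → β) (r : ℕ) (x : Φ) : Prop :=
  segMax τ ι lab r (ι x) < segMax τ ι lab r x

/-- A place where two adjacent forward flags face each other. -/
def IsSink (τ ι : Φ → Φ) (lab : Φ → β) (r : ℕ) (x : Φ) : Prop :=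
  IsForward τ ι lab r x ∧ τ x ≠ ι x ∧ ¬ IsForward τ ι lab r (τ x)

/-- A sink at a flag that sees no label as large as its own. -/
def IsPeak (τ ι : Φ → Φ) (lab : Φ → β) (r : ℕ) (x : Φ) : Prop :=
  IsSink τ ι lab r x ∧ segMax τ ι lab r (τ x) < segMax τ ι lab r x

namespace FlagSystem

variable {b : Φ → ℕ} {r : ℕ}

/-- A maximum attained after at least one step would also be seen from `τ x`, which a peak excludes.
-/
theorem _root_.IsPeak.segMax_eq {x : Φ} (h : IsPeak τ ι lab r x) : segMax τ ι lab r x = lab x := by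
  obtain ⟨k, hk, y, h1, h2⟩ := exists_segWalk_segMax (τ := τ) (ι := ι) (lab := lab) r x
  cases k with
  | zero => cases h1; exact h2
  | succ k => exact absurd (h1.2.lab_le_segMax (by omega)) (not_le.2 (h2 ▸ h.2))

/-- A peak is a local maximum in both directions: ahead by `IsPeak.segMax_eq`, behind because it is
forward. -/
theorem _root_.IsPeak.lab_le {f x y : Φ} {k : ℕ} (h : IsPeak τ ι lab r f) (hx : x = f ∨ x = ι f)
    (hw : SegWalk τ ι k x y) (hk : k ≤ r) : lab y ≤ lab f := by
  rw [← h.segMax_eq]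
  rcases hx with rfl | rfl
  · exact hw.lab_le_segMax hk
  · exact (hw.lab_le_segMax hk).trans h.1.1.le

variable (hs : FlagSystem τ ι lab b)
include hs

theorem inj : Function.Injective τ := by
  intro x y h
  have := hs.conj x
  rw [h, hs.conj] at this
  rw [← hs.invol x, ← this, hs.invol]

/-- As labels are injective, a common maximum would sit at one flag `y`, and the two walks to it
would combine to a walk from `ι y` to `y`. -/
theorem segMax_flip_ne (x : Φ) : segMax τ ι lab r (ι x) ≠ segMax τ ι lab r x := by
  intro h
  obtain ⟨k, _, y, h1, h2⟩ := exists_segWalk_segMax (τ := τ) (ι := ι) (lab := lab) r x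
  obtain ⟨j, _, z, h3, h4⟩ := exists_segWalk_segMax (τ := τ) (ι := ι) (lab := lab) r (ι x)
  obtain rfl : z = y := hs.lab_inj (by rw [← h2, ← h4, h])
  have h5 := h3.reverse hs.invol hs.conj
  rw [hs.invol] at h5
  exact not_segWalk_flip hs.invol hs.ne hs.conj _ _ (h5.append h1)

theorem isForward_flip_iff (x : Φ) : IsForward τ ι lab r (ι x) ↔ ¬ IsForward τ ι lab r x := by
  unfold IsForward
  rw [hs.invol, not_lt, le_iff_lt_or_eq]
  have := hs.segMax_flip_ne (r := r) x
  tauto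

theorem isSink_partner {x : Φ} (h : IsSink τ ι lab r x) : IsSink τ ι lab r (ι (τ x)) := by
  refine ⟨(hs.isForward_flip_iff _).2 h.2.2, ?_, ?_⟩
  · rw [hs.conj, hs.invol]; exact h.2.1.symm
  · rw [hs.conj, hs.isForward_flip_iff, not_not]; exact h.1

theorem partner_partner (x : Φ) : ι (τ (ι (τ x))) = x := by rw [hs.conj, hs.invol]

/-- If neither were a peak, the maxima seen from the two facing flags and from their reversals would
form a cycle of inequalities, two of them strict. -/
theorem isPeak_or_isPeak_partner {x : Φ} (h : IsSink τ ι lab r x) :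
    IsPeak τ ι lab r x ∨ IsPeak τ ι lab r (ι (τ x)) := by
  by_contra hcon
  rw [not_or] at hcon
  have h1 : segMax τ ι lab r x ≤ segMax τ ι lab r (τ x) := not_lt.1 fun h' => hcon.1 ⟨h, h'⟩
  have h2 : segMax τ ι lab r (ι (τ x)) ≤ segMax τ ι lab r (τ (ι (τ x))) :=
    not_lt.1 fun h' => hcon.2 ⟨hs.isSink_partner h, h'⟩
  rw [hs.conj] at h2
  have h3 : segMax τ ι lab r (ι x) < segMax τ ι lab r x := h.1
  have h4 := (hs.isSink_partner h).1
  unfold IsForward at h4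
  rw [hs.invol] at h4
  exact lt_irrefl _ (h1.trans_lt (h4.trans_le h2) |>.trans h3)

/-- On so short a cycle the peak would see its own label ahead, against the strict inequality of a
peak. -/
theorem not_segWalk_self_of_isPeak {f x : Φ} {k : ℕ} (h : IsPeak τ ι lab r f)
    (hx : x = f ∨ x = ι f) (hk : k + 1 ≤ r) : ¬ SegWalk τ ι (k + 1) x x := by
  intro hw
  have hw' : SegWalk τ ι (k + 1) f f := by
    rcases hx with rfl | rfl
    · exact hw
    · have := hw.reverse hs.invol hs.conj
      rwa [hs.invol] at this
  have := hw'.2.lab_le_segMax (lab := lab) (n := r) (by omega)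
  rw [← h.segMax_eq] at this
  exact not_lt.2 this h.2

/-- Each of the two peaks would see the other, so their base values would be equal. Then the walk
would return to its starting flag or to the reversal of it. -/
theorem not_segWalk_of_isPeak {f f' x x' : Φ} {s : ℕ} (h : IsPeak τ ι lab r f)
    (h' : IsPeak τ ι lab r f') (hx : x = f ∨ x = ι f) (hx' : x' = f' ∨ x' = ι f')
    (hk : s + 1 ≤ r) : ¬ SegWalk τ ι (s + 1) x' x := by
  intro hw
  have hbx : b x = b f := by rcases hx with rfl | rfl; exacts [rfl, hs.base_flip _]
  have hbx' : b x' = b f' := by rcases hx' with rfl | rfl; exacts [rfl, hs.base_flip _]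
  have h1 : b x ≤ b f' := hs.base_le _ _ h'.1.2.1 (h'.lab_le hx' hw hk)
  have hw2 := hw.reverse hs.invol hs.conj
  have hx2 : ι x = f ∨ ι x = ι f := by
    rcases hx with rfl | rfl
    · exact Or.inr rfl
    · exact Or.inl (hs.invol _)
  have h2 : b (ι x') ≤ b f := hs.base_le _ _ h.1.2.1 (h.lab_le hx2 hw2 hk)
  rw [hs.base_flip] at h2
  have h3 : b x = b x' := by omega
  rcases hs.base_inj _ _ h3.symm with rfl | rfl
  · exact hs.not_segWalk_self_of_isPeak h hx hk hw
  · exact not_segWalk_flip hs.invol hs.ne hs.conj _ (ι x') (by rwa [hs.invol])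

theorem eq_of_segWalk_of_isPeak {f f' x x' y : Φ} {k j : ℕ} (h : IsPeak τ ι lab r f)
    (h' : IsPeak τ ι lab r f') (hx : x = f ∨ x = ι f) (hx' : x' = f' ∨ x' = ι f')
    (hk : k ≤ r) (hj : j ≤ r) (hw : SegWalk τ ι k x y) (hw' : SegWalk τ ι j x' y) :
    x = x' ∧ k = j := by
  rcases lt_trichotomy k j with hlt | rfl | hlt
  · obtain ⟨s, rfl⟩ := Nat.exists_eq_add_of_lt hlt
    refine absurd (SegWalk.cancel (s := s + 1) hs.inj hw ?_)
      (hs.not_segWalk_of_isPeak h h' hx hx' (by omega))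
    rwa [show s + 1 + k = k + s + 1 by omega]
  · exact ⟨hs.inj.iterate k (hw.iterate_eq.trans hw'.iterate_eq.symm), rfl⟩
  · obtain ⟨s, rfl⟩ := Nat.exists_eq_add_of_lt hlt
    refine absurd (SegWalk.cancel (s := s + 1) hs.inj hw' ?_)
      (hs.not_segWalk_of_isPeak h' h hx' hx (by omega))
    rwa [show s + 1 + j = j + s + 1 by omega]

theorem flag_injective {f f' : Φ} {d d' : Bool} (h : IsPeak τ ι lab r f)
    (h' : IsPeak τ ι lab r f') (he : cond d f (ι f) = cond d' f' (ι f')) : f = f' ∧ d = d' := by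
  cases d <;> cases d' <;> simp only [cond_true, cond_false] at he
  · exact ⟨by rw [← hs.invol f, he, hs.invol], rfl⟩
  · exact absurd ((hs.isForward_flip_iff (r := r) f).1 (he ▸ h'.1.1)) (not_not.2 h.1.1)
  · exact absurd ((hs.isForward_flip_iff (r := r) f').1 (he ▸ h.1.1)) (not_not.2 h'.1.1)
  · exact ⟨he, rfl⟩

-- A charging argument: from each peak two walks of length `r` start, one in each direction, and all
-- these walks are disjoint. Each covers `r + 1` flags or runs into an end.
open Classical in
theorem card_isPeak_le {Fs : Finset Φ} (hFτ : ∀ x ∈ Fs, τ x ∈ Fs) (hFι : ∀ x ∈ Fs, ι x ∈ Fs)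
    {Top : Φ → Prop} (hTop : ∀ y f, Top y → τ f ≠ ι f → lab f < lab y) :
    (r + 1) * (2 * (Fs.filter (IsPeak τ ι lab r)).card) ≤
      Fs.card + (r + 1) * (Fs.filter fun y => τ y = ι y ∧ ¬ Top y).card := by
  set P := Fs.filter (IsPeak τ ι lab r) with hP
  set LE := Fs.filter fun y => τ y = ι y ∧ ¬ Top y with hLE
  -- A non-`Top` end gets the extra weight `r + 1`, so that a walk stopped there is paid for by this
  -- end alone.
  let wt : Φ → ℕ := fun y => 1 + (r + 1) * if y ∈ LE then 1 else 0
  let st : Φ × Bool → Φ := fun q => cond q.2 q.1 (ι q.1)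
  let Y : Φ × Bool → Finset Φ := fun q => Fs.filter fun y => ∃ k ≤ r, SegWalk τ ι k (st q) y
  have hst : ∀ q : Φ × Bool, st q = q.1 ∨ st q = ι q.1 := by
    rintro ⟨f, d⟩; cases d; exacts [Or.inr rfl, Or.inl rfl]
  have hwalk : ∀ k x y, x ∈ Fs → SegWalk τ ι k x y → y ∈ Fs := by
    intro k
    induction k with
    | zero => intro x y hx h; cases h; exact hx
    | succ k ih => intro x y hx h; exact ih _ _ (hFτ _ hx) h.2
  have hdisj : ∀ q ∈ P ×ˢ (Finset.univ : Finset Bool), ∀ q' ∈ P ×ˢ (Finset.univ : Finset Bool),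
      q ≠ q' → Disjoint (Y q) (Y q') := by
    intro q hq q' hq' hne
    rw [Finset.disjoint_left]
    intro y hy hy'
    simp only [Y, Finset.mem_filter] at hy hy'
    obtain ⟨-, k, hk, hw⟩ := hy
    obtain ⟨-, j, hj, hw'⟩ := hy'
    simp only [hP, Finset.mem_product, Finset.mem_filter, Finset.mem_univ, and_true] at hq hq'
    have h1 := (hs.eq_of_segWalk_of_isPeak hq.2 hq'.2 (hst q) (hst q') hk hj hw hw').1
    obtain ⟨h2, h3⟩ := hs.flag_injective hq.2 hq'.2 h1
    exact hne (Prod.ext h2 h3)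
  have hY : ∀ q ∈ P ×ˢ (Finset.univ : Finset Bool), r + 1 ≤ ∑ y ∈ Y q, wt y := by
    intro q hq
    simp only [hP, Finset.mem_product, Finset.mem_filter, Finset.mem_univ, and_true] at hq
    have hxF : st q ∈ Fs := by
      rcases hst q with h | h <;> rw [h]
      exacts [hq.1, hFι _ hq.1]
    by_cases hend : ∃ k ≤ r, ∃ y, SegWalk τ ι k (st q) y ∧ τ y = ι y
    · obtain ⟨k, hk, y, hw, hy⟩ := hend
      have hyF := hwalk _ _ _ hxF hw
      have hyL : y ∈ LE := by
        refine Finset.mem_filter.2 ⟨hyF, hy, fun ht => ?_⟩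
        -- A `Top` end in sight would have a larger label than the peak.
        exact absurd (hq.2.lab_le (hst q) hw hk) (not_le.2 (hTop y q.1 ht hq.2.1.2.1))
      have hyY : y ∈ Y q := Finset.mem_filter.2 ⟨hyF, k, hk, hw⟩
      calc r + 1 ≤ wt y := by simp only [wt, if_pos hyL]; omega
        _ ≤ _ := Finset.single_le_sum (f := wt) (fun _ _ => Nat.zero_le _) hyY
    · push Not at hend
      have hw : ∀ k ≤ r, SegWalk τ ι k (st q) (τ^[k] (st q)) := by
        intro k
        induction k with
        | zero => intro _; rfl
        | succ k ih =>
          intro hk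
          have h1 := ih (by omega)
          rw [Function.iterate_succ_apply']
          exact h1.snoc (hend k (by omega) _ h1)
      have hinj : Set.InjOn (fun k => τ^[k] (st q)) (Finset.range (r + 1) : Set ℕ) := by
        intro k hk j hj h
        simp only [Finset.coe_range, Set.mem_Iio] at hk hj
        have hj' := hw j (by omega)
        rw [← show τ^[k] (st q) = τ^[j] (st q) from h] at hj'
        exact (hs.eq_of_segWalk_of_isPeak hq.2 hq.2 (hst q) (hst q) (by omega) (by omega)
          (hw k (by omega)) hj').2
      calc r + 1 = (Finset.range (r + 1)).card := by simp
        _ ≤ (Y q).card := by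
          refine Finset.card_le_card_of_injOn _ (fun k hk => ?_) hinj
          have hk' : k ≤ r := by simpa [Nat.lt_succ_iff] using hk
          exact Finset.mem_coe.2 (Finset.mem_filter.2 ⟨hwalk _ _ _ hxF (hw k hk'), k, hk', hw k hk'⟩)
        _ = ∑ y ∈ Y q, 1 := by simp
        _ ≤ _ := Finset.sum_le_sum fun y _ => by simp only [wt]; omega
  calc (r + 1) * (2 * P.card) = ∑ q ∈ P ×ˢ (Finset.univ : Finset Bool), (r + 1) := by
        rw [Finset.sum_const, Finset.card_product]; simp; ring
    _ ≤ ∑ q ∈ P ×ˢ (Finset.univ : Finset Bool), ∑ y ∈ Y q, wt y := Finset.sum_le_sum hY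
    _ = ∑ y ∈ (P ×ˢ (Finset.univ : Finset Bool)).biUnion Y, wt y :=
        (Finset.sum_biUnion fun q hq q' hq' => hdisj q hq q' hq').symm
    _ ≤ ∑ y ∈ Fs, wt y := by
        refine Finset.sum_le_sum_of_subset fun y hy => ?_
        obtain ⟨q, -, hy⟩ := Finset.mem_biUnion.1 hy
        exact (Finset.mem_filter.1 hy).1
    _ = _ := by
        simp only [wt, Finset.sum_add_distrib, Finset.sum_const, smul_eq_mul, mul_one,
          ← Finset.mul_sum]
        congr 2
        rw [Finset.sum_boole, Nat.cast_id]
        congr 1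
        ext y
        simp only [hLE, Finset.mem_filter]
        tauto

open Classical in
theorem card_isSink_le {Fs : Finset Φ} (hFτ : ∀ x ∈ Fs, τ x ∈ Fs) (hFι : ∀ x ∈ Fs, ι x ∈ Fs) :
    (Fs.filter (IsSink τ ι lab r)).card ≤ 2 * (Fs.filter (IsPeak τ ι lab r)).card := by
  calc _ ≤ (Fs.filter (IsPeak τ ι lab r) ∪
          (Fs.filter (IsPeak τ ι lab r)).image fun x => ι (τ x)).card := by
        refine Finset.card_le_card fun x hx => ?_
        obtain ⟨hxF, hx⟩ := Finset.mem_filter.1 hx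
        rw [Finset.mem_union]
        rcases hs.isPeak_or_isPeak_partner hx with h | h
        · exact Or.inl (Finset.mem_filter.2 ⟨hxF, h⟩)
        · refine Or.inr (Finset.mem_image.2 ⟨ι (τ x), Finset.mem_filter.2 ⟨?_, h⟩, ?_⟩)
          · exact hFι _ (hFτ _ hxF)
          · exact hs.partner_partner x
    _ ≤ _ := (Finset.card_union_le _ _).trans
        (by have := Finset.card_image_le (s := Fs.filter (IsPeak τ ι lab r))
              (f := fun x => ι (τ x)); omega)

end FlagSystem

end Walk

/-! ### Selecting almost half of the elements, with few conflicts between mates -/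

section Split

variable {α : Type*}

/-- One step of a flag along the paths and cycles that two involutions form. -/
def flagStep (lam rho : α → α) (x : α × Bool) : α × Bool :=
  if x.2 then (rho x.1, false) else (lam x.1, true)

/-- The reversal of a flag. -/
def flagFlip (x : α × Bool) : α × Bool := (x.1, !x.2)

open Classical in
/-- The label of a flag: `rho`-ends come last, otherwise the numbers of the elements count. -/
noncomputable def flagLabel (rho : α → α) (b : α → ℕ) (x : α × Bool) : ℕ ×ₗ ℕ :=
  toLex (if x.2 = true ∧ rho x.1 = x.1 then 1 else 0, 2 * b x.1 + x.2.toNat)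

/-- The elements that are oriented from their `lam`-side to their `rho`-side. -/
def SplitSel (lam rho : α → α) (b : α → ℕ) (r : ℕ) (e : α) : Prop :=
  IsForward (flagStep lam rho) flagFlip (flagLabel rho b) r (e, true)

/-- The selected elements without one element of each pair of conflicting ones. -/
def SplitKeep (lam rho : α → α) (b : α → ℕ) (r : ℕ) (e : α) : Prop :=
  SplitSel lam rho b r e ∧
    (lam e = e ∨ ¬ SplitSel lam rho b r (lam e) ∨ b e < b (lam e)) ∧
    (rho e = e ∨ ¬ SplitSel lam rho b r (rho e) ∨ b e < b (rho e))

variable {lam rho : α → α} {b : α → ℕ}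

theorem flagSystem (hlam : Function.Involutive lam) (hrho : Function.Involutive rho)
    (hb : Function.Injective b) :
    FlagSystem (flagStep lam rho) flagFlip (flagLabel rho b) (fun x => b x.1) where
  invol := by rintro ⟨e, d⟩; simp [flagFlip]
  ne := by rintro ⟨e, d⟩; cases d <;> simp [flagFlip]
  conj := by rintro ⟨e, d⟩; cases d <;> simp [flagFlip, flagStep, hlam e, hrho e]
  lab_inj := by
    rintro ⟨e, d⟩ ⟨e', d'⟩ h
    have h2 : 2 * b e + d.toNat = 2 * b e' + d'.toNat := congrArg (fun p => (ofLex p).2) h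
    have h3 := Bool.toNat_le d
    have h4 := Bool.toNat_le d'
    have h5 : b e = b e' := by omega
    have h6 : d.toNat = d'.toNat := by omega
    have h7 : d = d' := by cases d <;> cases d' <;> simp_all
    rw [hb h5, h7]
  base_inj := by
    rintro ⟨e, d⟩ ⟨e', d'⟩ h
    obtain rfl : e = e' := hb h
    cases d <;> cases d' <;> simp [flagFlip]
  base_flip := by rintro ⟨e, d⟩; rfl
  base_le := by
    rintro ⟨e, d⟩ ⟨e', d'⟩ hy hle
    -- A flag that is not an end has first label component `0`, so any smaller label does too, and
    -- the comparison is by the numbers.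
    have hcl : ¬ (d' = true ∧ rho e' = e') := by
      rintro ⟨rfl, h⟩
      exact hy (by simp [flagStep, flagFlip, h])
    simp only [flagLabel, if_neg hcl, Prod.Lex.toLex_le_toLex] at hle
    have h3 := Bool.toNat_le d
    have h4 := Bool.toNat_le d'
    rcases hle with hle | hle
    · exact absurd hle (by simp)
    · have := hle.2
      show b e ≤ b e'
      omega

theorem flagLabel_lt_of_top {y f : α × Bool} (hy : y.2 = true ∧ rho y.1 = y.1)
    (hf : flagStep lam rho f ≠ flagFlip f) : flagLabel rho b f < flagLabel rho b y := by
  have hcl : ¬ (f.2 = true ∧ rho f.1 = f.1) := by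
    rintro ⟨h1, h⟩
    exact hf (by simp [flagStep, flagFlip, h, h1])
  simp only [flagLabel, if_neg hcl, if_pos hy, Prod.Lex.toLex_lt_toLex]
  exact Or.inl Nat.zero_lt_one

/-- At a `lam`-end the flag `(e, false)` sees only its own label, which is smaller than that of `(e,
true)`. -/
theorem splitSel_of_fixed {r : ℕ} {e : α} (h : lam e = e) : SplitSel lam rho b r e := by
  have hend : flagStep lam rho (e, false) = flagFlip (e, false) := by simp [flagStep, flagFlip, h]
  have h1 : segMax (flagStep lam rho) flagFlip (flagLabel rho b) r (e, false) =
      flagLabel rho b (e, false) := by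
    cases r with
    | zero => rfl
    | succ r => rw [segMax, if_pos hend]
  have h2 : flagLabel rho b (e, false) < flagLabel rho b (e, true) := by
    simp only [flagLabel, Prod.Lex.toLex_lt_toLex]
    by_cases h : rho e = e <;> simp [h]
  show segMax _ _ _ r (e, false) < _
  rw [h1]
  exact h2.trans_le (SegWalk.lab_le_segMax (k := 0) rfl (Nat.zero_le _))

open Classical in
/-- In a set closed under the involutions almost half of the elements are kept. -/
theorem card_le_splitKeep (hlam : Function.Involutive lam) (hrho : Function.Involutive rho)
    (hb : Function.Injective b) (r : ℕ) {E : Finset α} (hEl : ∀ e ∈ E, lam e ∈ E)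
    (hEr : ∀ e ∈ E, rho e ∈ E) :
    (r + 1) * E.card ≤ (r + 1) * (2 * (E.filter (SplitKeep lam rho b r)).card) + 2 * E.card := by
  have hs := flagSystem hlam hrho hb
  set sel := SplitSel lam rho b r with hsel
  have hfwd : ∀ e, IsForward (flagStep lam rho) flagFlip (flagLabel rho b) r (e, false) ↔
      ¬ sel e := fun e => hs.isForward_flip_iff (e, true)
  -- Consistent orientation along a path alternates between selected and unselected. Of the
  -- exceptions, `A` consists of sources, while `B` and `C` consist of sinks.
  set A := E.filter fun e => lam e ≠ e ∧ sel e ∧ sel (lam e) with hA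
  set B := E.filter fun e => lam e ≠ e ∧ ¬ sel e ∧ ¬ sel (lam e) with hB
  set C := E.filter fun e => rho e ≠ e ∧ sel e ∧ sel (rho e) with hC
  set U := E.filter fun e => lam e = e with hU
  -- A `lam`-pair has exactly one selected element, except for two in `A` and none in `B`; elements
  -- fixed by `lam` are always selected.
  have h1 : 2 * (E.filter sel).card + B.card = E.card + U.card + A.card := by
    have h2 : ∑ e ∈ E, (if sel (lam e) then 1 else 0) = ∑ e ∈ E, (if sel e then 1 else 0) :=
      Finset.sum_nbij' lam lam hEl hEl (fun e _ => hlam e) (fun e _ => hlam e) (fun e _ => rfl)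
    have h3 : ∑ e ∈ E, ((if sel e then 1 else 0) + (if sel (lam e) then 1 else 0) +
        (if lam e ≠ e ∧ ¬ sel e ∧ ¬ sel (lam e) then 1 else 0)) =
        ∑ e ∈ E, (1 + (if lam e = e then 1 else 0) +
          (if lam e ≠ e ∧ sel e ∧ sel (lam e) then 1 else 0)) := by
      refine Finset.sum_congr rfl fun e _ => ?_
      by_cases hf : lam e = e
      · have : sel e := splitSel_of_fixed hf
        simp [hf, this]
      · by_cases h4 : sel e <;> by_cases h5 : sel (lam e) <;> simp [hf, h4, h5]
    have hcard : ∀ (p : α → Prop) (i : DecidablePred p),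
        ∑ e ∈ E, (if p e then 1 else 0) = (E.filter p).card := by
      intro p i
      rw [Finset.card_filter]
    simp only [Finset.sum_add_distrib, h2, Finset.sum_const, smul_eq_mul, mul_one] at h3
    rw [hcard, hcard, hcard, hcard] at h3
    rw [hA, hB, hU]
    convert (show 2 * (E.filter sel).card + _ = _ from ?_) using 1
    rw [two_mul]; convert h3 using 1
  -- Resolving a conflict removes only one element of the pair, the one with the larger number.
  have hhalf : ∀ g : α → α, Function.Involutive g → (∀ e ∈ E, g e ∈ E) →
      2 * (E.filter fun e => (g e ≠ e ∧ sel e ∧ sel (g e)) ∧ b (g e) < b e).card ≤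
        (E.filter fun e => g e ≠ e ∧ sel e ∧ sel (g e)).card := by
    intro g hg hEg
    have h2 := Finset.card_filter_add_card_filter_not
      (s := E.filter fun e => g e ≠ e ∧ sel e ∧ sel (g e)) (fun e => b (g e) < b e)
    rw [Finset.filter_filter, Finset.filter_filter] at h2
    have h3 : (E.filter fun e => (g e ≠ e ∧ sel e ∧ sel (g e)) ∧ b (g e) < b e).card ≤
        (E.filter fun e => (g e ≠ e ∧ sel e ∧ sel (g e)) ∧ ¬ b (g e) < b e).card := by
      refine Finset.card_le_card_of_injOn g (fun e he => ?_) (hg.injective.injOn)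
      simp only [Finset.coe_filter, Set.mem_ofPred_eq] at he ⊢
      rw [hg e]
      exact ⟨hEg e he.1, ⟨he.2.1.1.symm, he.2.1.2.2, he.2.1.2.1⟩, by omega⟩
    omega
  have h4 : (E.filter sel).card ≤ (E.filter (SplitKeep lam rho b r)).card +
      (E.filter fun e => (lam e ≠ e ∧ sel e ∧ sel (lam e)) ∧ b (lam e) < b e).card +
      (E.filter fun e => (rho e ≠ e ∧ sel e ∧ sel (rho e)) ∧ b (rho e) < b e).card := by
    refine le_trans (Finset.card_le_card ?_)
      ((Finset.card_union_le _ _).trans (Nat.add_le_add_right (Finset.card_union_le _ _) _))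
    intro e he
    simp only [Finset.mem_union, Finset.mem_filter, SplitKeep, ← hsel] at he ⊢
    have hl : lam e ≠ e → b (lam e) ≠ b e := fun h h' => h (hb h')
    have hr : rho e ≠ e → b (rho e) ≠ b e := fun h h' => h (hb h')
    by_cases c1 : lam e ≠ e ∧ sel (lam e) ∧ b (lam e) < b e
    · tauto
    · by_cases c2 : rho e ≠ e ∧ sel (rho e) ∧ b (rho e) < b e
      · tauto
      · left; left
        refine ⟨he.1, he.2, ?_, ?_⟩
        · by_contra hcon
          push Not at hcon
          exact c1 ⟨hcon.1, hcon.2.1, lt_of_le_of_ne hcon.2.2 (hl hcon.1)⟩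
        · by_contra hcon
          push Not at hcon
          exact c2 ⟨hcon.1, hcon.2.1, lt_of_le_of_ne hcon.2.2 (hr hcon.1)⟩
  have h5 : 2 * (E.filter fun e => (lam e ≠ e ∧ sel e ∧ sel (lam e)) ∧ b (lam e) < b e).card ≤
      A.card := by
    rw [hA]; convert hhalf lam hlam hEl
  have h6 : 2 * (E.filter fun e => (rho e ≠ e ∧ sel e ∧ sel (rho e)) ∧ b (rho e) < b e).card ≤
      C.card := by
    rw [hC]; convert hhalf rho hrho hEr
  set Fs := E ×ˢ (Finset.univ : Finset Bool) with hFs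
  have hFτ : ∀ x ∈ Fs, flagStep lam rho x ∈ Fs := by
    rintro ⟨e, d⟩ hx
    simp only [hFs, Finset.mem_product, Finset.mem_univ, and_true] at hx ⊢
    cases d
    · exact hEl e hx
    · exact hEr e hx
  have hFι : ∀ x ∈ Fs, flagFlip x ∈ Fs := by
    rintro ⟨e, d⟩ hx
    simpa [hFs, flagFlip] using hx
  have h7 := hs.card_isPeak_le (r := r) hFτ hFι
    (Top := fun y => y.2 = true ∧ rho y.1 = y.1) (fun y f => flagLabel_lt_of_top)
  have h8 := hs.card_isSink_le (r := r) hFτ hFι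
  have h9 : B.card + C.card ≤
      (Fs.filter (IsSink (flagStep lam rho) flagFlip (flagLabel rho b) r)).card := by
    rw [← Finset.card_map (s := B) ⟨fun e => (e, false), fun x y h => congrArg Prod.fst h⟩,
      ← Finset.card_map (s := C) ⟨fun e => (e, true), fun x y h => congrArg Prod.fst h⟩,
      ← Finset.card_union_of_disjoint]
    · refine Finset.card_le_card ?_
      rintro ⟨e, d⟩ hx
      simp only [Finset.mem_union, Finset.mem_map, hB, hC, Finset.mem_filter] at hx
      rcases hx with ⟨e', ⟨h1, h2, h3, h4⟩, ⟨⟩⟩ | ⟨e', ⟨h1, h2, h3, h4⟩, ⟨⟩⟩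
      · refine Finset.mem_filter.2 ⟨by simpa [hFs] using h1, (hfwd _).2 h3, ?_, h4⟩
        simpa [flagStep, flagFlip] using h2
      · exact Finset.mem_filter.2 ⟨by simpa [hFs] using h1, h3,
          by simpa [flagStep, flagFlip] using h2, fun h => (hfwd _).1 h h4⟩
    · rw [Finset.disjoint_left]
      rintro ⟨e, d⟩ hx hx'
      simp only [Finset.mem_map] at hx hx'
      obtain ⟨_, _, h⟩ := hx
      obtain ⟨_, _, h'⟩ := hx'
      exact absurd (congrArg Prod.snd (h.trans h'.symm)) (by simp)
  have h10 : (Fs.filter fun y => flagStep lam rho y = flagFlip y ∧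
      ¬ (y.2 = true ∧ rho y.1 = y.1)).card ≤ U.card := by
    refine Finset.card_le_card_of_injOn Prod.fst ?_ ?_
    · rintro ⟨e, d⟩ hx
      simp only [hFs, Finset.coe_filter, Set.mem_ofPred_eq, Finset.mem_product] at hx
      cases d
      · exact Finset.mem_coe.2 (Finset.mem_filter.2 ⟨hx.1.1, congrArg Prod.fst hx.2.1⟩)
      · exact absurd ⟨rfl, congrArg Prod.fst hx.2.1⟩ hx.2.2
    · rintro ⟨e, d⟩ hx ⟨e', d'⟩ hx' h
      simp only [Finset.coe_filter, Set.mem_ofPred_eq] at hx hx'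
      obtain rfl : e = e' := h
      have hd : d = false := by
        cases d
        · rfl
        · exact absurd ⟨rfl, congrArg Prod.fst hx.2.1⟩ hx.2.2
      have hd' : d' = false := by
        cases d'
        · rfl
        · exact absurd ⟨rfl, congrArg Prod.fst hx'.2.1⟩ hx'.2.2
      rw [hd, hd']
  have h11 : Fs.card = 2 * E.card := by simp [hFs, mul_comm]
  rw [h11] at h7
  have h12 : (r + 1) * (B.card + C.card) ≤ 2 * E.card + (r + 1) * U.card :=
    (Nat.mul_le_mul_left _ (h9.trans h8)).trans
      (h7.trans (Nat.add_le_add_left (Nat.mul_le_mul_left _ (by convert h10)) _))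
  -- What is removed at sources is balanced by the surplus `A` in `h1`, so only sinks cost. The ends
  -- charged in `h12` cancel against `U` here.
  have h13 : E.card + U.card ≤ 2 * (E.filter (SplitKeep lam rho b r)).card + (B.card + C.card) := by
    omega
  clear h7 h8 h9 h10 h11
  have h14 := Nat.mul_le_mul_left (r + 1) h13
  rw [mul_add, mul_add] at h14
  omega

end Split

/-! ### Rounding weights that are powers of two -/

section Rounding

theorem exists_pairing (A : Finset ℕ) : ∃ g : ℕ → ℕ, Function.Involutive g ∧
    (∀ v ∈ A, g v ∈ A) ∧ (∀ v, v ∉ A → g v = v) ∧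
    ∀ v ∈ A, ∀ w ∈ A, g v = v → g w = w → v = w := by
  induction A using Finset.strongInduction with
  | H A ih =>
    by_cases hA : ∃ a ∈ A, ∃ c ∈ A, a ≠ c
    · obtain ⟨a, ha, c, hc, hac⟩ := hA
      obtain ⟨g, h1, h2, h3, h4⟩ := ih (A \ {a, c})
        (Finset.sdiff_ssubset (by simp [Finset.insert_subset_iff, ha, hc]) ⟨a, by simp⟩)
      have hmem : ∀ v, v ∈ A \ {a, c} ↔ v ∈ A ∧ v ≠ a ∧ v ≠ c := by
        intro v; simp [not_or]
      have hga : g a = a := h3 a (by simp)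
      have hgc : g c = c := h3 c (by simp)
      have hg : ∀ v, v ≠ a → v ≠ c → g v ≠ a ∧ g v ≠ c := by
        intro v hva hvc
        refine ⟨fun h => hva ?_, fun h => hvc ?_⟩
        · rw [← h1 v, h, hga]
        · rw [← h1 v, h, hgc]
      refine ⟨fun v => if v = a then c else if v = c then a else g v, ?_, ?_, ?_, ?_⟩
      · intro v
        by_cases hva : v = a
        · simp [hva, hac.symm]
        · by_cases hvc : v = c
          · simp [hvc, hac.symm]
          · simp [hva, hvc, hg v hva hvc, h1 v]
      · intro v hv
        by_cases hva : v = a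
        · simp [hva, hc]
        · by_cases hvc : v = c
          · simp [hvc, hac.symm, ha]
          · simp only [hva, hvc, if_false]
            exact ((hmem _).1 (h2 v ((hmem v).2 ⟨hv, hva, hvc⟩))).1
      · intro v hv
        have hva : v ≠ a := fun h => hv (h ▸ ha)
        have hvc : v ≠ c := fun h => hv (h ▸ hc)
        simp only [hva, hvc, if_false]
        exact h3 v fun h => hv ((hmem v).1 h).1
      · have hfix : ∀ v ∈ A, (if v = a then c else if v = c then a else g v) = v →
            v ∈ A \ {a, c} ∧ g v = v := by
          intro v hv h
          by_cases hva : v = a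
          · simp only [hva, if_true] at h; exact absurd h.symm hac
          · by_cases hvc : v = c
            · simp only [hvc, hac.symm, if_true, if_false] at h; exact absurd h hac
            · simp only [hva, hvc, if_false] at h
              exact ⟨(hmem v).2 ⟨hv, hva, hvc⟩, h⟩
        intro v hv w hw hv' hw'
        exact h4 v (hfix v hv hv').1 w (hfix w hw hw').1 (hfix v hv hv').2 (hfix w hw hw').2
    · push Not at hA
      exact ⟨id, fun _ => rfl, fun _ h => h, fun _ _ => rfl, fun v hv w hw _ _ => hA v hv w hw⟩

/-- An involution that pairs the elements of a finite set, up to at most one. -/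
noncomputable def pairing (A : Finset ℕ) : ℕ → ℕ := (exists_pairing A).choose

theorem pairing_involutive (A : Finset ℕ) : Function.Involutive (pairing A) :=
  (exists_pairing A).choose_spec.1

theorem pairing_mem {A : Finset ℕ} {v : ℕ} (h : v ∈ A) : pairing A v ∈ A :=
  (exists_pairing A).choose_spec.2.1 v h

theorem pairing_of_notMem {A : Finset ℕ} {v : ℕ} (h : v ∉ A) : pairing A v = v :=
  (exists_pairing A).choose_spec.2.2.1 v h

/-- The `+ 1` is for the element that may remain without a mate. -/
theorem two_mul_card_le_of_pairing {A S : Finset ℕ} (hS : S ⊆ A)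
    (h : ∀ v ∈ S, pairing A v ≠ v → pairing A v ∉ S) : 2 * S.card ≤ A.card + 1 := by
  have h1 := Finset.card_union_add_card_inter S (S.image (pairing A))
  rw [Finset.card_image_of_injective _ (pairing_involutive A).injective] at h1
  have h2 : (S ∪ S.image (pairing A)).card ≤ A.card := by
    refine Finset.card_le_card (Finset.union_subset hS ?_)
    intro v hv
    obtain ⟨w, hw, rfl⟩ := Finset.mem_image.1 hv
    exact pairing_mem (hS hw)
  have h3 : (S ∩ S.image (pairing A)).card ≤ 1 := by
    have hfix : ∀ v ∈ S ∩ S.image (pairing A), v ∈ A ∧ pairing A v = v := by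
      intro v hv
      obtain ⟨hv1, hv2⟩ := Finset.mem_inter.1 hv
      refine ⟨hS hv1, ?_⟩
      by_contra hne
      obtain ⟨w, hw, rfl⟩ := Finset.mem_image.1 hv2
      exact h _ hv1 hne (by rwa [pairing_involutive A w])
    refine Finset.card_le_one.2 fun v hv w hw => ?_
    exact (exists_pairing A).choose_spec.2.2.2 v (hfix v hv).1 w (hfix w hw).1 (hfix v hv).2
      (hfix w hw).2
  omega

-- The edge without a mate could cause an excess of `2 ^ i`. It exists only if the number of edges
-- of weight `2 ^ i` is odd; then the old sum is an odd multiple of `2 ^ i`, and so lies at least `2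
-- ^ i` below `2 ^ h`.
open Classical in
theorem sum_round_le {N i h : ℕ} (hi : i < h) {f : ℕ → ℕ} {S : ℕ → Prop}
    (hf : ∀ v, f v = 2 ^ i ∨ 2 ^ (i + 1) ∣ f v)
    (hS : ∀ v, S v → pairing ((Finset.range N).filter fun v => f v = 2 ^ i) v ≠ v →
      ¬ S (pairing ((Finset.range N).filter fun v => f v = 2 ^ i) v))
    (hsum : ∑ v ∈ Finset.range N, f v ≤ 2 ^ h) :
    ∑ v ∈ Finset.range N, (if f v = 2 ^ i then (if S v then 2 ^ (i + 1) else 0) else f v)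
      ≤ 2 ^ h := by
  set A := (Finset.range N).filter fun v => f v = 2 ^ i with hA
  rw [← Finset.sum_filter_add_sum_filter_not _ (fun v => f v = 2 ^ i), ← hA] at hsum ⊢
  have h1 : ∑ v ∈ A, f v = A.card * 2 ^ i := by
    rw [Finset.sum_congr rfl fun v hv => (Finset.mem_filter.1 hv).2, Finset.sum_const, smul_eq_mul]
  have h2 : ∑ v ∈ A, (if f v = 2 ^ i then (if S v then 2 ^ (i + 1) else 0) else f v) =
      (A.filter S).card * 2 ^ (i + 1) := by
    rw [Finset.sum_congr rfl fun v hv => if_pos (Finset.mem_filter.1 hv).2, ← Finset.sum_filter,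
      Finset.sum_const, smul_eq_mul]
  have h3 : ∑ v ∈ (Finset.range N).filter (fun v => ¬ f v = 2 ^ i),
      (if f v = 2 ^ i then (if S v then 2 ^ (i + 1) else 0) else f v) =
      ∑ v ∈ (Finset.range N).filter (fun v => ¬ f v = 2 ^ i), f v :=
    Finset.sum_congr rfl fun v hv => if_neg (Finset.mem_filter.1 hv).2
  obtain ⟨q, hq⟩ : 2 ^ (i + 1) ∣ ∑ v ∈ (Finset.range N).filter (fun v => ¬ f v = 2 ^ i), f v :=
    Finset.dvd_sum fun v hv => (hf v).resolve_left (Finset.mem_filter.1 hv).2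
  obtain ⟨p, hp⟩ : 2 ^ (i + 1) ∣ 2 ^ h := pow_dvd_pow 2 hi
  have h4 : 2 * (A.filter S).card ≤ A.card + 1 :=
    two_mul_card_le_of_pairing (Finset.filter_subset _ _) fun v hv hne hv' =>
      hS v (Finset.mem_filter.1 hv).2 hne (Finset.mem_filter.1 hv').2
  rw [h1, hq, hp, pow_succ] at hsum
  rw [h2, h3, hq, hp]
  have h5 : A.card + 2 * q ≤ 2 * p := by
    refine Nat.le_of_mul_le_mul_left (c := 2 ^ i) ?_ (by positivity)
    calc 2 ^ i * (A.card + 2 * q) = A.card * 2 ^ i + 2 ^ i * 2 * q := by ring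
      _ ≤ 2 ^ i * 2 * p := hsum
      _ = _ := by ring
  calc (A.filter S).card * 2 ^ (i + 1) + 2 ^ (i + 1) * q = 2 ^ (i + 1) * ((A.filter S).card + q) := by
        ring
    _ ≤ _ := Nat.mul_le_mul_left _ (by omega)

/-- The heads of the edges of weight `2 ^ i` at the tail `u`. -/
def outSet (N : ℕ) (w : ℕ → ℕ → ℕ) (i u : ℕ) : Finset ℕ :=
  (Finset.range N).filter fun v => w u v = 2 ^ i

/-- The tails of the edges of weight `2 ^ i` at the head `v`. -/
def inSet (N : ℕ) (w : ℕ → ℕ → ℕ) (i v : ℕ) : Finset ℕ :=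
  (Finset.range N).filter fun u => w u v = 2 ^ i

/-- The edge that is paired with a given edge at its tail. -/
noncomputable def tailMate (N : ℕ) (w : ℕ → ℕ → ℕ) (i : ℕ) (e : ℕ × ℕ) : ℕ × ℕ :=
  (e.1, pairing (outSet N w i e.1) e.2)

/-- The edge that is paired with a given edge at its head. -/
noncomputable def headMate (N : ℕ) (w : ℕ → ℕ → ℕ) (i : ℕ) (e : ℕ × ℕ) : ℕ × ℕ :=
  (pairing (inSet N w i e.2) e.1, e.2)

/-- The edges of weight `2 ^ i` that are rounded up. -/
def RoundUp (N r i : ℕ) (w : ℕ → ℕ → ℕ) (u v : ℕ) : Prop :=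
  SplitKeep (tailMate N w i) (headMate N w i) (fun e => Nat.pair e.1 e.2) r (u, v)

open Classical in
/-- One rounding step: about half of the edges of weight `2 ^ i` double their weight, and the
others lose it. -/
noncomputable def roundStep (N r i : ℕ) (w : ℕ → ℕ → ℕ) (u v : ℕ) : ℕ :=
  if w u v = 2 ^ i then (if RoundUp N r i w u v then 2 ^ (i + 1) else 0) else w u v

/-- The total weight of the edges with tail `u`. -/
def outSum (N : ℕ) (w : ℕ → ℕ → ℕ) (u : ℕ) : ℕ := ∑ v ∈ Finset.range N, w u v

/-- The total weight of the edges with head `v`. -/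
def inSum (N : ℕ) (w : ℕ → ℕ → ℕ) (v : ℕ) : ℕ := ∑ u ∈ Finset.range N, w u v

/-- The total weight. -/
def totalWeight (N : ℕ) (w : ℕ → ℕ → ℕ) : ℕ :=
  ∑ e ∈ Finset.range N ×ˢ Finset.range N, w e.1 e.2

theorem tailMate_involutive (N : ℕ) (w : ℕ → ℕ → ℕ) (i : ℕ) :
    Function.Involutive (tailMate N w i) := fun e => by
  simp only [tailMate, pairing_involutive (outSet N w i e.1) e.2]

theorem headMate_involutive (N : ℕ) (w : ℕ → ℕ → ℕ) (i : ℕ) :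
    Function.Involutive (headMate N w i) := fun e => by
  simp only [headMate, pairing_involutive (inSet N w i e.2) e.1]

theorem pair_injective : Function.Injective fun e : ℕ × ℕ => Nat.pair e.1 e.2 := by
  rintro ⟨a, b⟩ ⟨c, d⟩ h
  obtain ⟨h1, h2⟩ := Nat.pair_eq_pair.1 h
  exact Prod.ext h1 h2

variable {N r i h : ℕ} {w : ℕ → ℕ → ℕ}

theorem outSum_roundStep_le (hi : i < h) (hw : ∀ u v, w u v = 2 ^ i ∨ 2 ^ (i + 1) ∣ w u v) (u : ℕ)
    (hsum : outSum N w u ≤ 2 ^ h) : outSum N (roundStep N r i w) u ≤ 2 ^ h := by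
  refine sum_round_le hi (f := w u) (S := RoundUp N r i w u) (hw u) (fun v hv hne hv' => ?_) hsum
  have hne' : tailMate N w i (u, v) ≠ (u, v) := fun h => hne (congrArg Prod.snd h)
  have hv' : SplitKeep (tailMate N w i) (headMate N w i) (fun e => Nat.pair e.1 e.2) r
    (tailMate N w i (u, v)) := hv'
  -- If both mates were kept, each would have the smaller number.
  have h1 := (hv.2.1.resolve_left hne').resolve_left (not_not.2 hv'.1)
  have h2 := hv'.2.1
  rw [tailMate_involutive N w i] at h2
  have h3 := (h2.resolve_left (Ne.symm hne')).resolve_left (not_not.2 hv.1)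
  omega

theorem inSum_roundStep_le (hi : i < h) (hw : ∀ u v, w u v = 2 ^ i ∨ 2 ^ (i + 1) ∣ w u v) (v : ℕ)
    (hsum : inSum N w v ≤ 2 ^ h) : inSum N (roundStep N r i w) v ≤ 2 ^ h := by
  refine sum_round_le hi (f := fun u => w u v) (S := fun u => RoundUp N r i w u v)
    (fun u => hw u v) (fun u hv hne hv' => ?_) hsum
  have hne' : headMate N w i (u, v) ≠ (u, v) := fun h => hne (congrArg Prod.fst h)
  have hv' : SplitKeep (tailMate N w i) (headMate N w i) (fun e => Nat.pair e.1 e.2) r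
    (headMate N w i (u, v)) := hv'
  have h1 := (hv.2.2.resolve_left hne').resolve_left (not_not.2 hv'.1)
  have h2 := hv'.2.2
  rw [headMate_involutive N w i] at h2
  have h3 := (h2.resolve_left (Ne.symm hne')).resolve_left (not_not.2 hv.1)
  omega

/-- Doubling half of the edges of weight `2 ^ i` would preserve the total; `card_le_splitKeep`
bounds how many fewer than half are doubled. -/
theorem totalWeight_roundStep (N r i : ℕ) (w : ℕ → ℕ → ℕ) :
    (r + 1) * totalWeight N w ≤
      (r + 1) * totalWeight N (roundStep N r i w) + 2 * totalWeight N w := by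
  classical
  set R := Finset.range N ×ˢ Finset.range N with hR
  set E := R.filter fun e => w e.1 e.2 = 2 ^ i with hE
  have hmem : ∀ e, e ∈ E ↔ (e.1 < N ∧ e.2 < N) ∧ w e.1 e.2 = 2 ^ i := by
    intro e; simp [hE, hR]
  have h0 := card_le_splitKeep (tailMate_involutive N w i) (headMate_involutive N w i)
    pair_injective r (E := E)
    (fun e he => by
      have he := (hmem e).1 he
      have h1 := pairing_mem (A := outSet N w i e.1) (v := e.2) (by simp [outSet, he])
      simp only [outSet, Finset.mem_filter, Finset.mem_range] at h1
      exact (hmem _).2 ⟨⟨he.1.1, h1.1⟩, h1.2⟩)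
    (fun e he => by
      have he := (hmem e).1 he
      have h1 := pairing_mem (A := inSet N w i e.2) (v := e.1) (by simp [inSet, he])
      simp only [inSet, Finset.mem_filter, Finset.mem_range] at h1
      exact (hmem _).2 ⟨⟨h1.1, he.1.2⟩, h1.2⟩)
  set K := E.filter (SplitKeep (tailMate N w i) (headMate N w i)
    (fun e => Nat.pair e.1 e.2) r) with hK
  have h1 : totalWeight N w = E.card * 2 ^ i + ∑ e ∈ R.filter (fun e => ¬ w e.1 e.2 = 2 ^ i),
      w e.1 e.2 := by
    rw [totalWeight, ← hR, ← Finset.sum_filter_add_sum_filter_not R (fun e => w e.1 e.2 = 2 ^ i),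
      ← hE, Finset.sum_congr rfl fun e he => ((hmem e).1 he).2, Finset.sum_const, smul_eq_mul]
  have h2 : totalWeight N (roundStep N r i w) = K.card * 2 ^ (i + 1) +
      ∑ e ∈ R.filter (fun e => ¬ w e.1 e.2 = 2 ^ i), w e.1 e.2 := by
    rw [totalWeight, ← hR, ← Finset.sum_filter_add_sum_filter_not R (fun e => w e.1 e.2 = 2 ^ i),
      ← hE]
    congr 1
    · rw [hK, ← smul_eq_mul, ← Finset.sum_const, Finset.sum_filter (s := E)]
      refine Finset.sum_congr rfl fun e he => ?_
      rw [roundStep, if_pos ((hmem e).1 he).2]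
      rfl
    · exact Finset.sum_congr rfl fun e he => by rw [roundStep, if_neg (Finset.mem_filter.1 he).2]
  rw [h1, h2]
  have h3 := Nat.mul_le_mul_right (2 ^ i) h0
  rw [pow_succ]
  nlinarith [h3, Nat.zero_le (∑ e ∈ R.filter (fun e => ¬ w e.1 e.2 = 2 ^ i), w e.1 e.2)]

theorem roundStep_eq_zero (u v : ℕ) (h0 : w u v = 0) : roundStep N r i w u v = 0 := by
  rw [roundStep, if_neg (by rw [h0]; positivity), h0]

/-- All weights are `0` or powers of two that are at least `2 ^ i`. -/
def PowerWeights (i : ℕ) (w : ℕ → ℕ → ℕ) : Prop :=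
  ∀ u v, w u v = 0 ∨ ∃ j, i ≤ j ∧ w u v = 2 ^ j

theorem PowerWeights.eq_or_dvd (hw : PowerWeights i w) (u v : ℕ) :
    w u v = 2 ^ i ∨ 2 ^ (i + 1) ∣ w u v := by
  rcases hw u v with h | ⟨j, hj, h⟩
  · exact Or.inr (h ▸ dvd_zero _)
  · rcases hj.eq_or_lt with rfl | hj
    · exact Or.inl h
    · exact Or.inr (h ▸ pow_dvd_pow 2 hj)

theorem PowerWeights.roundStep (hw : PowerWeights i w) :
    PowerWeights (i + 1) (roundStep N r i w) := by
  intro u v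
  by_cases h : w u v = 2 ^ i
  · by_cases h' : RoundUp N r i w u v
    · exact Or.inr ⟨i + 1, le_rfl, by rw [_root_.roundStep, if_pos h, if_pos h']⟩
    · exact Or.inl (by rw [_root_.roundStep, if_pos h, if_neg h'])
  · rw [_root_.roundStep, if_neg h]
    rcases hw u v with h1 | ⟨j, hj, h1⟩
    · exact Or.inl h1
    · refine Or.inr ⟨j, ?_, h1⟩
      rcases hj.eq_or_lt with rfl | hj
      · exact absurd h1 h
      · exact hj

/-- The weights after the first `i` rounding steps. -/
noncomputable def roundWeights (N r : ℕ) (w : ℕ → ℕ → ℕ) : ℕ → ℕ → ℕ → ℕ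
  | 0 => w
  | i + 1 => roundStep N r i (roundWeights N r w i)

theorem roundWeights_spec (hw : PowerWeights 0 w) (ho : ∀ u, outSum N w u ≤ 2 ^ h)
    (hin : ∀ v, inSum N w v ≤ 2 ^ h) : ∀ i ≤ h, PowerWeights i (roundWeights N r w i) ∧
      (∀ u, outSum N (roundWeights N r w i) u ≤ 2 ^ h) ∧
      (∀ v, inSum N (roundWeights N r w i) v ≤ 2 ^ h) ∧
      ∀ u v, w u v = 0 → roundWeights N r w i u v = 0 := by
  intro i
  induction i with
  | zero => intro _; exact ⟨hw, ho, hin, fun _ _ h => h⟩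
  | succ i ih =>
    intro hi
    obtain ⟨h1, h2, h3, h4⟩ := ih (by omega)
    exact ⟨h1.roundStep, fun u => outSum_roundStep_le hi h1.eq_or_dvd u (h2 u),
      fun v => inSum_roundStep_le hi h1.eq_or_dvd v (h3 v),
      fun u v h => roundStep_eq_zero u v (h4 u v h)⟩

/-- With `r + 1 = 4 * h` a step loses at most a fraction `1 / (2 * h)`, and Bernoulli's inequality
bounds the product over `h` steps below by `1 / 2`. -/
theorem totalWeight_roundWeights (w : ℕ → ℕ → ℕ) (hh : 1 ≤ h) :
    totalWeight N w ≤ 2 * totalWeight N (roundWeights N (4 * h - 1) w h) := by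
  have h1 : ∀ i, (1 + -(1 / (2 * h)) : ℝ) ^ i * totalWeight N w ≤
      totalWeight N (roundWeights N (4 * h - 1) w i) := by
    have hh' : (1 : ℝ) ≤ h := by exact_mod_cast hh
    have hpos : (0 : ℝ) ≤ 1 + -(1 / (2 * h)) := by
      have : 1 / (2 * (h : ℝ)) ≤ 1 := by
        rw [div_le_one (by linarith)]; linarith
      linarith
    intro i
    induction i with
    | zero => simp [roundWeights]
    | succ i ih =>
      have h2 := totalWeight_roundStep N (4 * h - 1) i (roundWeights N (4 * h - 1) w i)
      rw [show 4 * h - 1 + 1 = 4 * h by omega] at h2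
      set a := totalWeight N (roundWeights N (4 * h - 1) w i)
      have h3 : totalWeight N (roundStep N (4 * h - 1) i (roundWeights N (4 * h - 1) w i)) =
        totalWeight N (roundWeights N (4 * h - 1) w (i + 1)) := rfl
      rw [h3] at h2
      set a' := totalWeight N (roundWeights N (4 * h - 1) w (i + 1))
      have h2' : 4 * (h : ℝ) * a ≤ 4 * h * a' + 2 * a := by exact_mod_cast h2
      have h4 : (1 + -(1 / (2 * h)) : ℝ) * a ≤ a' := by
        rw [← sub_nonneg] at h2' ⊢
        have : (a' - (1 + -(1 / (2 * h))) * a : ℝ) = (4 * h * a' + 2 * a - 4 * h * a) / (4 * h) := by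
          field_simp; ring
        rw [this]
        positivity
      calc _ = (1 + -(1 / (2 * h)) : ℝ) * ((1 + -(1 / (2 * h)) : ℝ) ^ i * totalWeight N w) := by
            ring
        _ ≤ (1 + -(1 / (2 * h)) : ℝ) * a := mul_le_mul_of_nonneg_left ih hpos
        _ ≤ a' := h4
  have hh' : (1 : ℝ) ≤ h := by exact_mod_cast hh
  have h2 : (1 / 2 : ℝ) ≤ (1 + -(1 / (2 * h)) : ℝ) ^ h := by
    have h3 := one_add_mul_le_pow (a := -(1 / (2 * (h : ℝ)))) (by
      have : 1 / (2 * (h : ℝ)) ≤ 1 := by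
        rw [div_le_one (by linarith)]; linarith
      linarith) h
    have h4 : (1 + (h : ℝ) * -(1 / (2 * (h : ℝ)))) = 1 / 2 := by field_simp; ring
    rw [h4] at h3
    exact h3
  have h3 := mul_le_mul_of_nonneg_right h2 (Nat.cast_nonneg (α := ℝ) (totalWeight N w))
  have h4 := h3.trans (h1 h)
  have h5 : (totalWeight N w : ℝ) ≤ 2 * totalWeight N (roundWeights N (4 * h - 1) w h) := by
    linarith
  exact_mod_cast h5

end Rounding

/-! ### A fractional matching of constant approximation ratio -/

section Growth

variable {N h : ℕ} {E : ℕ → ℕ → Prop}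

open Classical in
/-- Weight `1` on each edge. -/
noncomputable def unitWeights (E : ℕ → ℕ → Prop) (u v : ℕ) : ℕ := if E u v then 1 else 0

/-- The edges without an endpoint of at least half the full weight double their weight. -/
def growStep (N h : ℕ) (w : ℕ → ℕ → ℕ) (u v : ℕ) : ℕ :=
  if 2 * outSum N w u < 2 ^ h ∧ 2 * inSum N w v < 2 ^ h then 2 * w u v else w u v

/-- The weights after some steps of growth. -/
noncomputable def growWeights (N h : ℕ) (E : ℕ → ℕ → Prop) : ℕ → ℕ → ℕ → ℕ
  | 0 => unitWeights E
  | t + 1 => growStep N h (growWeights N h E t)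

open Classical in
/-- The edges of a relation on `0, …, N - 1`. -/
noncomputable def relEdges (N : ℕ) (E : ℕ → ℕ → Prop) : Finset (ℕ × ℕ) :=
  (Finset.range N ×ˢ Finset.range N).filter fun e => E e.1 e.2

theorem mem_relEdges {e : ℕ × ℕ} :
    e ∈ relEdges N E ↔ (e.1 < N ∧ e.2 < N) ∧ E e.1 e.2 := by
  simp [relEdges]

theorem le_growStep (w : ℕ → ℕ → ℕ) (u v : ℕ) : w u v ≤ growStep N h w u v := by
  unfold growStep; split_ifs <;> omega

theorem growStep_le (w : ℕ → ℕ → ℕ) (u v : ℕ) : growStep N h w u v ≤ 2 * w u v := by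
  unfold growStep; split_ifs <;> omega

-- Doubling happens only below half capacity, so capacities are respected. Weights never decrease,
-- so an end that is half full remains so, and an edge that never met such an end has doubled each
-- time.
open Classical in
theorem growWeights_spec
    (ho : ∀ u, ((Finset.range N).filter fun v => E u v).card ≤ 2 ^ h)
    (hi : ∀ v, ((Finset.range N).filter fun u => E u v).card ≤ 2 ^ h) (t : ℕ) :
    PowerWeights 0 (growWeights N h E t) ∧
      (∀ u, outSum N (growWeights N h E t) u ≤ 2 ^ h) ∧
      (∀ v, inSum N (growWeights N h E t) v ≤ 2 ^ h) ∧
      (∀ u v, ¬ E u v → growWeights N h E t u v = 0) ∧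
      ∀ u v, E u v → 2 ^ h ≤ 2 * outSum N (growWeights N h E t) u ∨
        2 ^ h ≤ 2 * inSum N (growWeights N h E t) v ∨ growWeights N h E t u v = 2 ^ t := by
  induction t with
  | zero =>
    refine ⟨fun u v => ?_, fun u => ?_, fun v => ?_, fun u v huv => ?_, fun u v huv => ?_⟩
    · by_cases huv : E u v
      · exact Or.inr ⟨0, le_rfl, by simp [growWeights, unitWeights, huv]⟩
      · exact Or.inl (by simp [growWeights, unitWeights, huv])
    · simpa [growWeights, unitWeights, outSum, Finset.sum_boole] using ho u
    · simpa [growWeights, unitWeights, inSum, Finset.sum_boole] using hi v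
    · simp [growWeights, unitWeights, huv]
    · simp [growWeights, unitWeights, huv]
  | succ t ih =>
    obtain ⟨h1, h2, h3, h4, h5⟩ := ih
    set w := growWeights N h E t with hw
    have hstep : growWeights N h E (t + 1) = growStep N h w := rfl
    rw [hstep]
    have hout : ∀ u, outSum N w u ≤ outSum N (growStep N h w) u := fun u =>
      Finset.sum_le_sum fun v _ => le_growStep w u v
    have hin : ∀ v, inSum N w v ≤ inSum N (growStep N h w) v := fun v =>
      Finset.sum_le_sum fun u _ => le_growStep w u v
    refine ⟨fun u v => ?_, fun u => ?_, fun v => ?_, fun u v huv => ?_, fun u v huv => ?_⟩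
    · rcases h1 u v with h | ⟨j, _, h⟩
      · left; unfold growStep; rw [h]; simp
      · right
        unfold growStep
        split_ifs
        · exact ⟨j + 1, by omega, by rw [h]; ring⟩
        · exact ⟨j, by omega, h⟩
    · by_cases hu : 2 * outSum N w u < 2 ^ h
      · calc outSum N (growStep N h w) u ≤ ∑ v ∈ Finset.range N, 2 * w u v :=
              Finset.sum_le_sum fun v _ => growStep_le w u v
          _ = 2 * outSum N w u := by rw [← Finset.mul_sum]; rfl
          _ ≤ _ := hu.le
      · refine le_of_eq_of_le ?_ (h2 u)
        exact Finset.sum_congr rfl fun v _ => if_neg fun hc => hu hc.1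
    · by_cases hv : 2 * inSum N w v < 2 ^ h
      · calc inSum N (growStep N h w) v ≤ ∑ u ∈ Finset.range N, 2 * w u v :=
              Finset.sum_le_sum fun u _ => growStep_le w u v
          _ = 2 * inSum N w v := by rw [← Finset.mul_sum]; rfl
          _ ≤ _ := hv.le
      · refine le_of_eq_of_le ?_ (h3 v)
        exact Finset.sum_congr rfl fun u _ => if_neg fun hc => hv hc.2
    · have := growStep_le (N := N) (h := h) w u v
      rw [h4 u v huv] at this
      omega
    · have h6 := hout u
      have h7 := hin v
      by_cases hc : 2 * outSum N w u < 2 ^ h ∧ 2 * inSum N w v < 2 ^ h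
      · right; right
        rw [growStep, if_pos hc, ((h5 u v huv).resolve_left (by omega)).resolve_left (by omega)]
        ring
      · rcases not_and_or.1 hc with hc | hc <;> omega

-- An edge that has doubled `h` times has weight `2 ^ h` and fills its tail alone.
open Classical in
theorem half_tight_of_growWeights
    (ho : ∀ u, ((Finset.range N).filter fun v => E u v).card ≤ 2 ^ h)
    (hi : ∀ v, ((Finset.range N).filter fun u => E u v).card ≤ 2 ^ h)
    (hE : ∀ u v, E u v → u < N ∧ v < N) {u v : ℕ} (huv : E u v) :
    2 ^ h ≤ 2 * outSum N (growWeights N h E h) u ∨ 2 ^ h ≤ 2 * inSum N (growWeights N h E h) v := by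
  rcases (growWeights_spec ho hi h).2.2.2.2 u v huv with h1 | h1 | h1
  · exact Or.inl h1
  · exact Or.inr h1
  · left
    have : growWeights N h E h u v ≤ outSum N (growWeights N h E h) u :=
      Finset.single_le_sum (f := fun v => growWeights N h E h u v) (fun _ _ => Nat.zero_le _)
        (Finset.mem_range.2 (hE u v huv).2)
    omega

theorem totalWeight_eq_sum_outSum (N : ℕ) (w : ℕ → ℕ → ℕ) :
    totalWeight N w = ∑ u ∈ Finset.range N, outSum N w u := Finset.sum_product _ _ _

theorem totalWeight_eq_sum_inSum (N : ℕ) (w : ℕ → ℕ → ℕ) :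
    totalWeight N w = ∑ v ∈ Finset.range N, inSum N w v := Finset.sum_product_right _ _ _

theorem mul_card_le_sum_of_injOn {ι : Type*} {P : Finset ι} {g : ι → ℕ} {f : ℕ → ℕ} {c : ℕ}
    (hg : Set.InjOn g (P : Set ι)) (hN : ∀ e ∈ P, g e < N) (hf : ∀ e ∈ P, c ≤ 2 * f (g e)) :
    c * P.card ≤ 2 * ∑ u ∈ Finset.range N, f u := by
  classical
  calc c * P.card = ∑ e ∈ P, c := by rw [Finset.sum_const, smul_eq_mul, mul_comm]
    _ ≤ ∑ e ∈ P, 2 * f (g e) := Finset.sum_le_sum hf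
    _ = ∑ u ∈ P.image g, 2 * f u := (Finset.sum_image (f := fun u => 2 * f u) hg).symm
    _ ≤ ∑ u ∈ Finset.range N, 2 * f u := by
        refine Finset.sum_le_sum_of_subset fun u hu => ?_
        obtain ⟨e, he, rfl⟩ := Finset.mem_image.1 hu
        exact Finset.mem_range.2 (hN e he)
    _ = _ := by rw [Finset.mul_sum]

-- Each edge of `P` is charged to a half-full end. Distinct edges have distinct tails and distinct
-- heads, so tails and heads each account for at most twice the total weight.
open Classical in
theorem card_le_totalWeight_growWeights
    (ho : ∀ u, ((Finset.range N).filter fun v => E u v).card ≤ 2 ^ h)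
    (hi : ∀ v, ((Finset.range N).filter fun u => E u v).card ≤ 2 ^ h)
    (hE : ∀ u v, E u v → u < N ∧ v < N) {P : Finset (ℕ × ℕ)} (hP : ∀ e ∈ P, E e.1 e.2)
    (hfst : Set.InjOn Prod.fst (P : Set (ℕ × ℕ))) (hsnd : Set.InjOn Prod.snd (P : Set (ℕ × ℕ))) :
    2 ^ h * P.card ≤ 4 * totalWeight N (growWeights N h E h) := by
  set w := growWeights N h E h with hw
  have h1 := mul_card_le_sum_of_injOn (N := N) (P := P.filter fun e => 2 ^ h ≤ 2 * outSum N w e.1)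
    (g := Prod.fst) (f := outSum N w) (c := 2 ^ h)
    (hfst.mono (Finset.coe_subset.2 (Finset.filter_subset _ _)))
    (fun e he => (hE _ _ (hP e (Finset.mem_filter.1 he).1)).1) (fun e he => (Finset.mem_filter.1 he).2)
  have h2 := mul_card_le_sum_of_injOn (N := N) (P := P.filter fun e => 2 ^ h ≤ 2 * inSum N w e.2)
    (g := Prod.snd) (f := inSum N w) (c := 2 ^ h)
    (hsnd.mono (Finset.coe_subset.2 (Finset.filter_subset _ _)))
    (fun e he => (hE _ _ (hP e (Finset.mem_filter.1 he).1)).2) (fun e he => (Finset.mem_filter.1 he).2)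
  rw [← totalWeight_eq_sum_outSum] at h1
  rw [← totalWeight_eq_sum_inSum] at h2
  have h3 : P.card ≤ (P.filter fun e => 2 ^ h ≤ 2 * outSum N w e.1).card +
      (P.filter fun e => 2 ^ h ≤ 2 * inSum N w e.2).card := by
    refine (Finset.card_le_card fun e he => ?_).trans (Finset.card_union_le _ _)
    rw [Finset.mem_union, Finset.mem_filter, Finset.mem_filter]
    rcases half_tight_of_growWeights ho hi hE (hP e he) with h | h
    · exact Or.inl ⟨he, h⟩
    · exact Or.inr ⟨he, h⟩
  have h4 := Nat.mul_le_mul_left (2 ^ h) h3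
  rw [mul_add] at h4
  omega

end Growth

/-! ### Greedy matchings in directed paths -/

section Greedy

open Classical in
/-- A color for `a` from the lowest position where the binary representations of `a` and `b`
differ, and the digit of `a` at this position. -/
noncomputable def bitColor (a b : ℕ) : ℕ :=
  if h : ∃ i, a.testBit i ≠ b.testBit i then 2 * Nat.find h + (a.testBit (Nat.find h)).toNat
  else (a.testBit 0).toNat

/-- Equal colors would mean the same position and the same digit there, but `a` and `b` differ at
this position. The default for `c = b` is the color of position `0`, so the argument covers it. -/
theorem bitColor_ne {a b : ℕ} (hab : a ≠ b) (c : ℕ) : bitColor a b ≠ bitColor b c := by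
  classical
  have hex : ∃ i, a.testBit i ≠ b.testBit i := by
    by_contra hcon
    push Not at hcon
    exact hab (Nat.eq_of_testBit_eq hcon)
  intro h
  have hspec := Nat.find_spec hex
  have key : ∀ i, 2 * Nat.find hex + (a.testBit (Nat.find hex)).toNat = 2 * i + (b.testBit i).toNat →
      False := by
    intro i hi
    have h1 := Bool.toNat_le (a.testBit (Nat.find hex))
    have h2 := Bool.toNat_le (b.testBit i)
    have h3 : Nat.find hex = i := by omega
    rw [h3] at hi hspec
    have h4 : (a.testBit i).toNat = (b.testBit i).toNat := by omega
    exact hspec (by revert h4; cases a.testBit i <;> cases b.testBit i <;> simp)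
  unfold bitColor at h
  rw [dif_pos hex] at h
  split_ifs at h with h'
  · exact key _ h
  · exact key 0 (by omega)

theorem bitColor_lt {a b m : ℕ} (hm : 1 ≤ m) (ha : a < 2 ^ m) (hb : b < 2 ^ m) :
    bitColor a b < 2 * m := by
  classical
  unfold bitColor
  split_ifs with h
  · have h1 : Nat.find h < m := by
      by_contra hcon
      refine Nat.find_spec h ?_
      have h2 : 2 ^ m ≤ 2 ^ Nat.find h := Nat.pow_le_pow_right (by norm_num) (not_lt.1 hcon)
      rw [Nat.testBit_lt_two_pow (ha.trans_le h2), Nat.testBit_lt_two_pow (hb.trans_le h2)]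
    have h2 := Bool.toNat_le (a.testBit (Nat.find h))
    omega
  · have h2 := Bool.toNat_le (a.testBit 0)
    omega

/-- A vertex is touched by a relation if it belongs to one of its edges. -/
def Touched (M : ℕ → ℕ → Prop) (u : ℕ) : Prop := ∃ x, M u x ∨ M x u

/-- A set of disjoint edges, each of them directed to its larger endpoint. -/
structure DirMatching (M : ℕ → ℕ → Prop) : Prop where
  lt : ∀ {u v}, M u v → u < v
  disj : ∀ {u v u' v'}, M u v → M u' v' → u = u' ∨ u = v' ∨ v = u' ∨ v = v' → u = u' ∧ v = v'

theorem DirMatching.mono {M M' : ℕ → ℕ → Prop} (h : DirMatching M)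
    (hle : ∀ u v, M' u v → M u v) : DirMatching M' :=
  ⟨fun h' => h.lt (hle _ _ h'), fun h1 h2 => h.disj (hle _ _ h1) (hle _ _ h2)⟩

theorem DirMatching.union {M M' : ℕ → ℕ → Prop} (h : DirMatching M) (h' : DirMatching M')
    (hd : ∀ u v, M' u v → ¬ Touched M u ∧ ¬ Touched M v) :
    DirMatching fun u v => M u v ∨ M' u v := by
  refine ⟨fun huv => huv.elim h.lt h'.lt, ?_⟩
  have key : ∀ {u v u' v'}, M u v → M' u' v' → u = u' ∨ u = v' ∨ v = u' ∨ v = v' → False := by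
    rintro u v u' v' h1 h2 (rfl | rfl | rfl | rfl)
    · exact (hd _ _ h2).1 ⟨_, Or.inl h1⟩
    · exact (hd _ _ h2).2 ⟨_, Or.inl h1⟩
    · exact (hd _ _ h2).1 ⟨_, Or.inr h1⟩
    · exact (hd _ _ h2).2 ⟨_, Or.inr h1⟩
  rintro u v u' v' (h1 | h1) (h2 | h2) hs
  · exact h.disj h1 h2 hs
  · exact (key h1 h2 hs).elim
  · refine (key h2 h1 ?_).elim
    rcases hs with h | h | h | h <;> simp [h]
  · exact h'.disj h1 h2 hs

open Classical in
/-- The label of the edge that leaves `v`, and `d` if there is none. -/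
noncomputable def nextLabel (F : ℕ → ℕ → Prop) (κ : ℕ → ℕ → ℕ) (d v : ℕ) : ℕ :=
  if h : ∃ x, F v x then κ v h.choose else d

/-- The class of an edge in a set of directed paths, from its label and the label of the next
edge. -/
noncomputable def edgeClass (F : ℕ → ℕ → Prop) (κ : ℕ → ℕ → ℕ) (u v : ℕ) : ℕ :=
  bitColor (κ u v) (nextLabel F κ (κ u v) v)

/-- The matching that takes greedily the edges of the classes `0, …, j - 1`. -/
def greedy (F : ℕ → ℕ → Prop) (ξ : ℕ → ℕ → ℕ) : ℕ → ℕ → ℕ → Prop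
  | 0 => fun _ _ => False
  | j + 1 => fun u v => greedy F ξ j u v ∨
      (F u v ∧ ξ u v = j ∧ ¬ Touched (greedy F ξ j) u ∧ ¬ Touched (greedy F ξ j) v)

variable {F : ℕ → ℕ → Prop} {κ ξ : ℕ → ℕ → ℕ}

theorem edgeClass_ne (ho : ∀ u v v', F u v → F u v' → v = v') {u v x : ℕ} (hvx : F v x)
    (hκ : κ u v ≠ κ v x) : edgeClass F κ u v ≠ edgeClass F κ v x := by
  have hex : ∃ y, F v y := ⟨x, hvx⟩
  have h1 : nextLabel F κ (κ u v) v = κ v x := by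
    rw [nextLabel, dif_pos hex, ho v _ x hex.choose_spec hvx]
  rw [edgeClass, h1]
  exact bitColor_ne hκ _

theorem edgeClass_lt {m : ℕ} (hm : 1 ≤ m) (hκ : ∀ u v, κ u v < 2 ^ m) (u v : ℕ) :
    edgeClass F κ u v < 2 * m := by
  refine bitColor_lt hm (hκ u v) ?_
  unfold nextLabel
  split_ifs
  exacts [hκ _ _, hκ _ _]

theorem greedy_le (j u v : ℕ) (h : greedy F ξ j u v) : F u v := by
  induction j with
  | zero => exact h.elim
  | succ j ih => exact h.elim ih fun h => h.1

theorem greedy_mono {j j' : ℕ} (hj : j ≤ j') {u v : ℕ} (h : greedy F ξ j u v) :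
    greedy F ξ j' u v := by
  induction hj with
  | refl => exact h
  | step _ ih => exact Or.inl ih

/-- Edges of one class may be added simultaneously: by `ho` and `hi` two edges of `F` that meet are
consecutive, and those have different classes. -/
theorem dirMatching_greedy (hlt : ∀ u v, F u v → u < v) (ho : ∀ u v v', F u v → F u v' → v = v')
    (hi : ∀ u u' v, F u v → F u' v → u = u') (hξ : ∀ u v x, F u v → F v x → ξ u v ≠ ξ v x)
    (j : ℕ) : DirMatching (greedy F ξ j) := by
  induction j with
  | zero => exact ⟨fun h => h.elim, fun h => h.elim⟩
  | succ j ih =>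
    refine ih.union (M' := fun u v => F u v ∧ ξ u v = j ∧ ¬ Touched (greedy F ξ j) u ∧
      ¬ Touched (greedy F ξ j) v) ⟨fun h => hlt _ _ h.1, ?_⟩ (fun u v h => h.2.2)
    rintro u v u' v' ⟨h1, h2, -⟩ ⟨h1', h2', -⟩ (rfl | rfl | rfl | rfl)
    · exact ⟨rfl, ho _ _ _ h1 h1'⟩
    · exact absurd (h2'.trans h2.symm) (hξ _ _ _ h1' h1)
    · exact absurd (h2.trans h2'.symm) (hξ _ _ _ h1 h1')
    · exact ⟨hi _ _ _ h1 h1', rfl⟩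

/-- When its class is processed, an edge is either blocked or taken. -/
theorem touched_greedy {j u v : ℕ} (h : F u v) (hj : ξ u v < j) :
    Touched (greedy F ξ j) u ∨ Touched (greedy F ξ j) v := by
  have hmono : ∀ {x}, Touched (greedy F ξ (ξ u v)) x → Touched (greedy F ξ j) x :=
    fun ⟨y, hy⟩ => ⟨y, hy.imp (greedy_mono hj.le) (greedy_mono hj.le)⟩
  by_cases h1 : Touched (greedy F ξ (ξ u v)) u
  · exact Or.inl (hmono h1)
  · by_cases h2 : Touched (greedy F ξ (ξ u v)) v
    · exact Or.inr (hmono h2)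
    · exact Or.inl ⟨v, Or.inl (greedy_mono (j := ξ u v + 1) hj (Or.inr ⟨h, rfl, h1, h2⟩))⟩

variable {N : ℕ}

open Classical in
theorem card_touched_le {M : ℕ → ℕ → Prop} (hM : ∀ u v, M u v → u < N ∧ v < N) :
    ((Finset.range N).filter (Touched M)).card ≤ 2 * (relEdges N M).card := by
  calc _ ≤ ((relEdges N M).image Prod.fst ∪ (relEdges N M).image Prod.snd).card := by
        refine Finset.card_le_card fun u hu => ?_
        obtain ⟨x, hx | hx⟩ := (Finset.mem_filter.1 hu).2
        · exact Finset.mem_union_left _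
            (Finset.mem_image.2 ⟨(u, x), mem_relEdges.2 ⟨hM _ _ hx, hx⟩, rfl⟩)
        · exact Finset.mem_union_right _
            (Finset.mem_image.2 ⟨(x, u), mem_relEdges.2 ⟨hM _ _ hx, hx⟩, rfl⟩)
    _ ≤ (relEdges N M).card + (relEdges N M).card :=
        (Finset.card_union_le _ _).trans (Nat.add_le_add Finset.card_image_le Finset.card_image_le)
    _ = _ := by ring

/-- There are at most `2 * |M|` touched vertices, and each lies on at most one outgoing and one
incoming edge of `F`. -/
theorem card_relEdges_le_of_touched {M : ℕ → ℕ → Prop} (hM : ∀ u v, M u v → u < N ∧ v < N)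
    (ho : ∀ u v v', F u v → F u v' → v = v') (hi : ∀ u u' v, F u v → F u' v → u = u')
    (hmax : ∀ u v, F u v → Touched M u ∨ Touched M v) :
    (relEdges N F).card ≤ 4 * (relEdges N M).card := by
  classical
  set T := (Finset.range N).filter (Touched M) with hT
  have h1 : ((relEdges N F).filter fun e => Touched M e.1).card ≤ T.card := by
    refine Finset.card_le_card_of_injOn Prod.fst (fun e he => ?_) ?_
    · have he := Finset.mem_filter.1 he
      exact Finset.mem_coe.2 (Finset.mem_filter.2
        ⟨Finset.mem_range.2 (mem_relEdges.1 he.1).1.1, he.2⟩)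
    · rintro ⟨u, v⟩ he ⟨u', v'⟩ he' h
      obtain rfl : u = u' := h
      rw [ho u v v' (mem_relEdges.1 (Finset.mem_filter.1 he).1).2
        (mem_relEdges.1 (Finset.mem_filter.1 he').1).2]
  have h2 : ((relEdges N F).filter fun e => Touched M e.2).card ≤ T.card := by
    refine Finset.card_le_card_of_injOn Prod.snd (fun e he => ?_) ?_
    · have he := Finset.mem_filter.1 he
      exact Finset.mem_coe.2 (Finset.mem_filter.2
        ⟨Finset.mem_range.2 (mem_relEdges.1 he.1).1.2, he.2⟩)
    · rintro ⟨u, v⟩ he ⟨u', v'⟩ he' h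
      obtain rfl : v = v' := h
      rw [hi u u' v (mem_relEdges.1 (Finset.mem_filter.1 he).1).2
        (mem_relEdges.1 (Finset.mem_filter.1 he').1).2]
  have h3 : (relEdges N F).card ≤ ((relEdges N F).filter fun e => Touched M e.1).card +
      ((relEdges N F).filter fun e => Touched M e.2).card := by
    refine (Finset.card_le_card fun e he => ?_).trans (Finset.card_union_le _ _)
    rw [Finset.mem_union, Finset.mem_filter, Finset.mem_filter]
    exact (hmax _ _ (mem_relEdges.1 he).2).imp (⟨he, ·⟩) (⟨he, ·⟩)
  have h4 := card_touched_le hM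
  rw [← hT] at h4
  omega

end Greedy

/-! ### Constant-factor matchings and their iteration -/

section Matching

variable {N h m : ℕ} {E : ℕ → ℕ → Prop} {κ : ℕ → ℕ → ℕ}

/-- The edges whose weight is rounded to the full weight. -/
def roundedEdges (N h : ℕ) (E : ℕ → ℕ → Prop) (u v : ℕ) : Prop :=
  roundWeights N (4 * h - 1) (growWeights N h E h) h u v = 2 ^ h

/-- A matching whose size is at least a constant fraction of the largest possible one. -/
noncomputable def constMatching (N h m : ℕ) (κ : ℕ → ℕ → ℕ) (E : ℕ → ℕ → Prop) : ℕ → ℕ → Prop :=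
  greedy (roundedEdges N h E) (edgeClass (roundedEdges N h E) κ) (2 * m)

open Classical in
/-- The conditions on a directed graph for the computation of a matching. -/
structure GoodEdges (N h : ℕ) (κ : ℕ → ℕ → ℕ) (E : ℕ → ℕ → Prop) : Prop where
  lt : ∀ u v, E u v → u < v
  bound : ∀ u v, E u v → u < N ∧ v < N
  outDegree : ∀ u, ((Finset.range N).filter fun v => E u v).card ≤ 2 ^ h
  inDegree : ∀ v, ((Finset.range N).filter fun u => E u v).card ≤ 2 ^ h
  label : ∀ u v x, E u v → E v x → κ u v ≠ κ v x

open Classical in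
theorem GoodEdges.mono (hE : GoodEdges N h κ E) {E' : ℕ → ℕ → Prop}
    (hle : ∀ u v, E' u v → E u v) : GoodEdges N h κ E' where
  lt u v huv := hE.lt u v (hle _ _ huv)
  bound u v huv := hE.bound u v (hle _ _ huv)
  outDegree u := (Finset.card_le_card (Finset.monotone_filter_right _
    fun v _ => hle u v)).trans (hE.outDegree u)
  inDegree v := (Finset.card_le_card (Finset.monotone_filter_right _
    fun u _ => hle u v)).trans (hE.inDegree v)
  label u v x huv hvx := hE.label u v x (hle _ _ huv) (hle _ _ hvx)

theorem eq_of_sum_le {c : ℕ} (hc : 0 < c) {f : ℕ → ℕ} (hsum : ∑ v ∈ Finset.range N, f v ≤ c)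
    {v v' : ℕ} (hv : v < N) (hv' : v' < N) (h1 : f v = c) (h2 : f v' = c) : v = v' := by
  by_contra hne
  have := Finset.sum_le_sum_of_subset (f := f) (s := {v, v'}) (t := Finset.range N)
    (by simp [Finset.insert_subset_iff, hv, hv'])
  rw [Finset.sum_pair hne] at this
  omega

namespace GoodEdges

variable (hE : GoodEdges N h κ E)
include hE

theorem roundWeights_spec : PowerWeights h (roundWeights N (4 * h - 1) (growWeights N h E h) h) ∧
    (∀ u, outSum N (roundWeights N (4 * h - 1) (growWeights N h E h) h) u ≤ 2 ^ h) ∧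
    (∀ v, inSum N (roundWeights N (4 * h - 1) (growWeights N h E h) h) v ≤ 2 ^ h) ∧
    ∀ u v, ¬ E u v → roundWeights N (4 * h - 1) (growWeights N h E h) h u v = 0 := by
  obtain ⟨h1, h2, h3, h4, -⟩ := growWeights_spec hE.outDegree hE.inDegree h
  obtain ⟨h5, h6, h7, h8⟩ := _root_.roundWeights_spec (r := 4 * h - 1) h1 h2 h3 h le_rfl
  exact ⟨h5, h6, h7, fun u v huv => h8 u v (h4 u v huv)⟩

theorem of_roundedEdges {u v : ℕ} (huv : roundedEdges N h E u v) : E u v := by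
  by_contra hcon
  have h1 : 0 = 2 ^ h := (hE.roundWeights_spec.2.2.2 u v hcon).symm.trans huv
  exact absurd h1 (by positivity)

theorem roundedEdges_out (u v v' : ℕ) (h1 : roundedEdges N h E u v)
    (h2 : roundedEdges N h E u v') : v = v' :=
  eq_of_sum_le (by positivity) (hE.roundWeights_spec.2.1 u) (hE.bound _ _ (hE.of_roundedEdges h1)).2
    (hE.bound _ _ (hE.of_roundedEdges h2)).2 h1 h2

theorem roundedEdges_in (u u' v : ℕ) (h1 : roundedEdges N h E u v)
    (h2 : roundedEdges N h E u' v) : u = u' :=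
  eq_of_sum_le (by positivity) (hE.roundWeights_spec.2.2.1 v)
    (hE.bound _ _ (hE.of_roundedEdges h1)).1 (hE.bound _ _ (hE.of_roundedEdges h2)).1 h1 h2

/-- Nonzero weights are now at least `2 ^ h`, and the capacity allows no more. -/
theorem totalWeight_eq : totalWeight N (roundWeights N (4 * h - 1) (growWeights N h E h) h) =
    2 ^ h * (relEdges N (roundedEdges N h E)).card := by
  classical
  obtain ⟨h5, h6, -, -⟩ := hE.roundWeights_spec
  set w := roundWeights N (4 * h - 1) (growWeights N h E h) h with hw
  have hle : ∀ u v, v < N → w u v ≤ 2 ^ h := fun u v hv =>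
    (Finset.single_le_sum (f := fun v => w u v) (fun _ _ => Nat.zero_le _)
      (Finset.mem_range.2 hv)).trans (h6 u)
  have h7 : ∀ e ∈ Finset.range N ×ˢ Finset.range N,
      w e.1 e.2 = if roundedEdges N h E e.1 e.2 then 2 ^ h else 0 := by
    intro e he
    rw [Finset.mem_product, Finset.mem_range, Finset.mem_range] at he
    split_ifs with hc
    · exact hc
    · rcases h5 e.1 e.2 with h8 | ⟨j, hj, h8⟩
      · exact h8
      · have h9 := hle e.1 e.2 he.2
        rw [h8] at h9
        have h10 : j ≤ h := (Nat.pow_le_pow_iff_right (by norm_num)).1 h9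
        obtain rfl : j = h := le_antisymm h10 hj
        exact absurd h8 hc
  rw [totalWeight, Finset.sum_congr rfl h7, ← Finset.sum_filter, Finset.sum_const, smul_eq_mul,
    mul_comm]
  rfl

theorem dirMatching_constMatching : DirMatching (constMatching N h m κ E) :=
  dirMatching_greedy (ξ := edgeClass (roundedEdges N h E) κ) (fun _ _ huv => hE.lt _ _ (hE.of_roundedEdges huv)) hE.roundedEdges_out
    hE.roundedEdges_in (fun u v x huv hvx => edgeClass_ne hE.roundedEdges_out hvx
      (hE.label u v x (hE.of_roundedEdges huv) (hE.of_roundedEdges hvx))) _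

theorem of_constMatching {u v : ℕ} (huv : constMatching N h m κ E u v) : E u v :=
  hE.of_roundedEdges (greedy_le _ _ _ huv)

/-- The constant is `4 * 2 * 4`, from growth, rounding and the greedy choice. -/
theorem card_le_constMatching (hh : 1 ≤ h) (hm : 1 ≤ m) (hκ : ∀ u v, κ u v < 2 ^ m)
    {P : ℕ → ℕ → Prop} (hP : DirMatching P) (hPE : ∀ u v, P u v → E u v) :
    (relEdges N P).card ≤ 32 * (relEdges N (constMatching N h m κ E)).card := by
  have h1 := card_le_totalWeight_growWeights hE.outDegree hE.inDegree hE.bound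
    (P := relEdges N P) (fun e he => hPE _ _ (mem_relEdges.1 he).2)
    (fun e he e' he' hee => by
      have := hP.disj (mem_relEdges.1 he).2 (mem_relEdges.1 he').2 (Or.inl hee)
      exact Prod.ext this.1 this.2)
    (fun e he e' he' hee => by
      have := hP.disj (mem_relEdges.1 he).2 (mem_relEdges.1 he').2 (Or.inr (Or.inr (Or.inr hee)))
      exact Prod.ext this.1 this.2)
  have h2 := totalWeight_roundWeights (N := N) (growWeights N h E h) hh
  rw [hE.totalWeight_eq] at h2
  have h3 : (relEdges N P).card ≤ 8 * (relEdges N (roundedEdges N h E)).card := by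
    refine Nat.le_of_mul_le_mul_left (c := 2 ^ h) ?_ (by positivity)
    linarith
  have h4 : (relEdges N (roundedEdges N h E)).card ≤
      4 * (relEdges N (constMatching N h m κ E)).card :=
    card_relEdges_le_of_touched (fun u v huv => hE.bound _ _ (hE.of_constMatching huv))
      hE.roundedEdges_out hE.roundedEdges_in
      fun u v huv => touched_greedy huv (edgeClass_lt hm hκ u v)
  omega

end GoodEdges

/-- The edges of `E` without an endpoint in the matching `M`. -/
def remaining (E M : ℕ → ℕ → Prop) (u v : ℕ) : Prop :=
  E u v ∧ ¬ Touched M u ∧ ¬ Touched M v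

/-- The union of the matchings found in the first `s` iterations. -/
noncomputable def iterMatching (N h m : ℕ) (κ : ℕ → ℕ → ℕ) (E : ℕ → ℕ → Prop) :
    ℕ → ℕ → ℕ → Prop
  | 0 => fun _ _ => False
  | s + 1 => fun u v => iterMatching N h m κ E s u v ∨
      constMatching N h m κ (remaining E (iterMatching N h m κ E s)) u v

theorem card_relEdges_union {P Q : ℕ → ℕ → Prop} (h : ∀ u v, P u v → ¬ Q u v) :
    (relEdges N fun u v => P u v ∨ Q u v).card = (relEdges N P).card + (relEdges N Q).card := by
  classical
  rw [← Finset.card_union_of_disjoint]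
  · congr 1
    ext e
    simp only [Finset.mem_union, mem_relEdges]
    tauto
  · rw [Finset.disjoint_left]
    intro e he he'
    exact h _ _ (mem_relEdges.1 he).2 (mem_relEdges.1 he').2

namespace GoodEdges

variable (hE : GoodEdges N h κ E)
include hE

theorem remaining (M : ℕ → ℕ → Prop) : GoodEdges N h κ (remaining E M) :=
  hE.mono fun _ _ huv => huv.1

theorem iterMatching_spec (s : ℕ) : DirMatching (iterMatching N h m κ E s) ∧
    ∀ u v, iterMatching N h m κ E s u v → E u v := by
  induction s with
  | zero => exact ⟨⟨fun h => h.elim, fun h => h.elim⟩, fun _ _ h => h.elim⟩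
  | succ s ih =>
    have h1 := hE.remaining (iterMatching N h m κ E s)
    exact ⟨ih.1.union h1.dirMatching_constMatching fun u v huv => (h1.of_constMatching huv).2,
      fun u v huv => huv.elim (ih.2 u v) fun huv => (h1.of_constMatching huv).1⟩

/-- A matching `P` that remains and the newly found `Q` together form a matching that was available
before, and `Q` makes up at least `1 / 32` of it. -/
theorem card_remaining_le (hh : 1 ≤ h) (hm : 1 ≤ m) (hκ : ∀ u v, κ u v < 2 ^ m) {ν : ℝ}
    (hν : ∀ P, DirMatching P → (∀ u v, P u v → E u v) → ((relEdges N P).card : ℝ) ≤ ν) (s : ℕ) :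
    ∀ P, DirMatching P → (∀ u v, P u v → _root_.remaining E (iterMatching N h m κ E s) u v) →
      ((relEdges N P).card : ℝ) ≤ (31 / 32) ^ s * ν := by
  induction s with
  | zero =>
    intro P hP hPE
    simpa using hν P hP fun u v huv => (hPE u v huv).1
  | succ s ih =>
    intro P hP hPE
    set Q := constMatching N h m κ (_root_.remaining E (iterMatching N h m κ E s)) with hQ
    have h1 := hE.remaining (iterMatching N h m κ E s)
    have hnt : ∀ x, ¬ Touched (iterMatching N h m κ E (s + 1)) x →
        ¬ Touched (iterMatching N h m κ E s) x ∧ ¬ Touched Q x := fun x hx =>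
      ⟨fun ⟨y, hy⟩ => hx ⟨y, hy.imp Or.inl Or.inl⟩, fun ⟨y, hy⟩ => hx ⟨y, hy.imp Or.inr Or.inr⟩⟩
    have hQm : DirMatching Q := h1.dirMatching_constMatching
    have hU : DirMatching fun u v => Q u v ∨ P u v := hQm.union hP fun u v huv =>
      ⟨(hnt u (hPE u v huv).2.1).2, (hnt v (hPE u v huv).2.2).2⟩
    have hUE : ∀ u v, (Q u v ∨ P u v) → _root_.remaining E (iterMatching N h m κ E s) u v := by
      rintro u v (huv | huv)
      · exact h1.of_constMatching huv
      · exact ⟨(hPE u v huv).1, (hnt u (hPE u v huv).2.1).1, (hnt v (hPE u v huv).2.2).1⟩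
    have h2 := ih _ hU hUE
    have h3 : ((relEdges N fun u v => Q u v ∨ P u v).card : ℝ) ≤ 32 * (relEdges N Q).card := by
      exact_mod_cast h1.card_le_constMatching hh hm hκ hU hUE
    have h4 : ((relEdges N fun u v => Q u v ∨ P u v).card : ℝ) =
        (relEdges N Q).card + (relEdges N P).card := by
      exact_mod_cast card_relEdges_union fun u v huv huv' =>
        (hnt u (hPE u v huv').2.1).2 ⟨v, Or.inl huv⟩
    rw [pow_succ]
    linarith

theorem card_le_iterMatching (hh : 1 ≤ h) (hm : 1 ≤ m) (hκ : ∀ u v, κ u v < 2 ^ m) {s : ℕ} {ε : ℝ}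
    (hε : 0 < ε) (hs : (2 + ε) * (31 / 32 : ℝ) ^ s ≤ ε) {P : ℕ → ℕ → Prop} (hP : DirMatching P)
    (hPE : ∀ u v, P u v → E u v) :
    ((relEdges N P).card : ℝ) ≤ (2 + ε) * (relEdges N (iterMatching N h m κ E s)).card := by
  classical
  -- The shrinking bound is applied with `ν` the maximum size of a matching, not the size of `P`.
  obtain ⟨Q, hQ, hQE, hmax⟩ : ∃ Q, DirMatching Q ∧ (∀ u v, Q u v → E u v) ∧
      ∀ P, DirMatching P → (∀ u v, P u v → E u v) → (relEdges N P).card ≤ (relEdges N Q).card := by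
    have hne : {n | ∃ Q, (DirMatching Q ∧ ∀ u v, Q u v → E u v) ∧ (relEdges N Q).card = n}.Nonempty :=
      ⟨_, fun _ _ => False, ⟨⟨fun h => h.elim, fun h => h.elim⟩, fun _ _ h => h.elim⟩, rfl⟩
    have hbdd : BddAbove
        {n | ∃ Q, (DirMatching Q ∧ ∀ u v, Q u v → E u v) ∧ (relEdges N Q).card = n} := by
      refine ⟨(Finset.range N ×ˢ Finset.range N).card, ?_⟩
      rintro _ ⟨Q, -, rfl⟩
      exact Finset.card_filter_le _ _
    obtain ⟨Q, hQ, hc⟩ := Nat.sSup_mem hne hbdd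
    exact ⟨Q, hQ.1, hQ.2, fun P hP hPE => hc ▸ le_csSup hbdd ⟨P, ⟨hP, hPE⟩, rfl⟩⟩
  set M := iterMatching N h m κ E s with hM
  have hMs : DirMatching M ∧ ∀ u v, M u v → E u v := hE.iterMatching_spec s
  have h1 := hE.card_remaining_le hh hm hκ (ν := (relEdges N Q).card)
    (fun P hP hPE => by exact_mod_cast hmax P hP hPE) s
    (fun u v => Q u v ∧ ¬ Touched M u ∧ ¬ Touched M v) (hQ.mono fun u v huv => huv.1)
    (fun u v huv => ⟨hQE u v huv.1, huv.2⟩)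
  set T := (Finset.range N).filter (Touched M) with hT
  -- Each such edge is charged to a touched endpoint; the edges of `Q` are disjoint, so this is
  -- injective.
  have h2 : (relEdges N fun u v => Q u v ∧ (Touched M u ∨ Touched M v)).card ≤ T.card := by
    refine Finset.card_le_card_of_injOn (fun e => if Touched M e.1 then e.1 else e.2) ?_ ?_
    · intro e he
      have he := mem_relEdges.1 he
      refine Finset.mem_coe.2 (Finset.mem_filter.2 ?_)
      by_cases hc : Touched M e.1
      · simp [hc, he.1.1]
      · simp [hc, he.1.2, he.2.2.resolve_left hc]
    · intro e he e' he' hee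
      have he := (mem_relEdges.1 he).2.1
      have he' := (mem_relEdges.1 he').2.1
      have : e.1 = e'.1 ∨ e.1 = e'.2 ∨ e.2 = e'.1 ∨ e.2 = e'.2 := by
        simp only at hee
        split_ifs at hee <;> tauto
      have := hQ.disj he he' this
      exact Prod.ext this.1 this.2
  have h3 : (relEdges N Q).card =
      (relEdges N fun u v => Q u v ∧ ¬ Touched M u ∧ ¬ Touched M v).card +
      (relEdges N fun u v => Q u v ∧ (Touched M u ∨ Touched M v)).card := by
    rw [← card_relEdges_union (by tauto)]
    congr 1
    ext e
    simp only [mem_relEdges]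
    tauto
  have h4 := card_touched_le (N := N) (M := M) fun u v huv => hE.bound u v (hMs.2 u v huv)
  have h5 : ((relEdges N Q).card : ℝ) ≤ (31 / 32) ^ s * (relEdges N Q).card +
      2 * (relEdges N M).card := by
    have h6 : (relEdges N fun u v => Q u v ∧ (Touched M u ∨ Touched M v)).card ≤
      2 * (relEdges N M).card := h2.trans h4
    have h7 : ((relEdges N fun u v => Q u v ∧ (Touched M u ∨ Touched M v)).card : ℝ) ≤
      2 * (relEdges N M).card := by exact_mod_cast h6
    have h8 : ((relEdges N Q).card : ℝ) =
      (relEdges N fun u v => Q u v ∧ ¬ Touched M u ∧ ¬ Touched M v).card +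
      (relEdges N fun u v => Q u v ∧ (Touched M u ∨ Touched M v)).card := by exact_mod_cast h3
    linarith
  have h6 : ((relEdges N P).card : ℝ) ≤ (relEdges N Q).card := by exact_mod_cast hmax P hP hPE
  refine h6.trans ?_
  -- By `hs`, `(2 + ε) * |Q| ≤ ε * |Q| + 2 * (2 + ε) * |M|`, and `ε * |Q|` cancels.
  have h7 := mul_le_mul_of_nonneg_left h5 (show 0 ≤ 2 + ε by linarith)
  have h8 := mul_le_mul_of_nonneg_right hs (Nat.cast_nonneg (α := ℝ) (relEdges N Q).card)
  linarith

end GoodEdges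

end Matching

/-! ### The iterated logarithm of a polynomially larger number -/

section LogStar

theorem logStar_le_of_iterate {x : ℝ} {k : ℕ} (h : (Real.logb 2)^[k] x ≤ 1) : logStar x ≤ k :=
  Nat.sInf_le h

theorem iterate_logStar_le (x : ℝ) : (Real.logb 2)^[logStar x] x ≤ 1 :=
  Nat.sInf_mem (logStar_set_nonempty x)

theorem one_lt_iterate {x : ℝ} {k : ℕ} (h : k < logStar x) : 1 < (Real.logb 2)^[k] x := by
  by_contra hcon
  exact absurd (logStar_le_of_iterate (not_lt.1 hcon)) (not_le.2 h)

theorem logStar_mono {x y : ℝ} (hxy : x ≤ y) : logStar x ≤ logStar y := by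
  have key : ∀ (k : ℕ) (x y : ℝ), x ≤ y → (Real.logb 2)^[k] y ≤ 1 → logStar x ≤ k := by
    intro k
    induction k with
    | zero => intro x y h h'; exact logStar_le_of_iterate (h.trans h')
    | succ k ih =>
      intro x y h h'
      by_cases hx : x ≤ 1
      · exact (logStar_le_of_iterate (k := 0) hx).trans (Nat.zero_le _)
      · rw [not_le] at hx
        have h1 := ih (Real.logb 2 x) (Real.logb 2 y)
          (Real.logb_le_logb_of_le (by norm_num) (by linarith) h) h'
        exact (logStar_le_of_iterate (k := logStar (Real.logb 2 x) + 1)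
          (iterate_logStar_le (Real.logb 2 x))).trans (by omega)
  exact key _ x y hxy (iterate_logStar_le y)

theorem logStar_le_add {x y : ℝ} {k : ℕ} (h : (Real.logb 2)^[k] x ≤ y) :
    logStar x ≤ k + logStar y := by
  refine (logStar_le_of_iterate (k := logStar ((Real.logb 2)^[k] x) + k) ?_).trans ?_
  · rw [Function.iterate_add_apply]; exact iterate_logStar_le _
  · have := logStar_mono h
    omega

theorem logb_two_mul_le {c : ℕ} (hc : 1 ≤ c) : Real.logb 2 (2 * c) ≤ c := by
  have hc' : (1 : ℝ) ≤ c := by exact_mod_cast hc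
  rw [Real.logb_le_iff_le_rpow (by norm_num) (by linarith), Real.rpow_natCast]
  obtain ⟨d, rfl⟩ := Nat.exists_eq_add_of_le' hc
  have : d + 1 ≤ 2 ^ d := Nat.lt_two_pow_self
  rw [pow_succ]
  have h2 : ((d + 1 : ℕ) : ℝ) ≤ 2 ^ d := by exact_mod_cast this
  linarith

/-- The relation `x ≤ c * y + c` survives a logarithm: for `y > 1` it gives `x ≤ 2 * c * y`, and
`log (2 * c) ≤ c`. -/
theorem exists_iterate_le {c : ℕ} (hc : 1 ≤ c) (k : ℕ) : ∀ x y : ℝ, x ≤ c * y + c →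
    (Real.logb 2)^[k] y ≤ 1 → ∃ j ≤ k, (Real.logb 2)^[j] x ≤ 2 * c := by
  have hc' : (1 : ℝ) ≤ c := by exact_mod_cast hc
  have hsmall : ∀ x y : ℝ, x ≤ c * y + c → y ≤ 1 → x ≤ 2 * c := by
    intro x y h h'
    have := mul_le_mul_of_nonneg_left h' (show (0 : ℝ) ≤ c by linarith)
    linarith
  induction k with
  | zero => intro x y h h'; exact ⟨0, le_rfl, hsmall x y h h'⟩
  | succ k ih =>
    intro x y h h'
    by_cases hy : y ≤ 1
    · exact ⟨0, Nat.zero_le _, hsmall x y h hy⟩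
    by_cases hx : x ≤ 2 * c
    · exact ⟨0, Nat.zero_le _, hx⟩
    rw [not_le] at hx hy
    have hlogy : 0 < Real.logb 2 y := Real.logb_pos (by norm_num) hy
    have h1 : Real.logb 2 x ≤ c * Real.logb 2 y + c := by
      have h2 : x ≤ 2 * c * y := by nlinarith
      have h3 := Real.logb_le_logb_of_le (b := 2) (by norm_num) (by linarith) h2
      rw [Real.logb_mul (by linarith) (by linarith)] at h3
      have h4 := logb_two_mul_le hc
      have h5 : Real.logb 2 y ≤ c * Real.logb 2 y := by nlinarith
      linarith
    obtain ⟨j, hj, h2⟩ := ih _ _ h1 h'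
    exact ⟨j + 1, by omega, h2⟩

theorem logStar_le_of_le_pow (c : ℕ) {n N : ℕ} (h : N ≤ n ^ c) :
    logStar (N : ℝ) ≤ logStar (n : ℝ) + logStar (2 * (c + 1 : ℕ) : ℝ) := by
  by_cases hN : (N : ℝ) ≤ 1
  · exact (logStar_le_of_iterate (k := 0) hN).trans (Nat.zero_le _)
  rw [not_le] at hN
  have hNR : (N : ℝ) ≤ (n : ℝ) ^ c := by exact_mod_cast h
  have hn : (1 : ℝ) < n := by
    by_contra hcon
    have : (n : ℝ) ^ c ≤ 1 := pow_le_one₀ (Nat.cast_nonneg n) (not_lt.1 hcon)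
    linarith
  -- The first logarithm turns the power bound into a linear one. It is counted in `log* n` because
  -- `n > 1`.
  obtain ⟨k, hk⟩ : ∃ k, logStar (n : ℝ) = k + 1 := by
    refine Nat.exists_eq_succ_of_ne_zero fun h0 => ?_
    have := iterate_logStar_le (n : ℝ)
    rw [h0] at this
    exact absurd hn (not_lt.2 this)
  have h1 := iterate_logStar_le (n : ℝ)
  rw [hk, Function.iterate_succ_apply] at h1
  have h2 : Real.logb 2 N ≤ (c + 1 : ℕ) * Real.logb 2 n + (c + 1 : ℕ) := by
    have h3 := Real.logb_le_logb_of_le (b := 2) (by norm_num) (by linarith) hNR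
    rw [Real.logb_pow] at h3
    have h4 : 0 < Real.logb 2 n := Real.logb_pos (by norm_num) hn
    push_cast
    nlinarith [Nat.cast_nonneg (α := ℝ) c]
  obtain ⟨j, hj, h3⟩ := exists_iterate_le (by omega) k _ _ h2 h1
  have h4 := logStar_le_add (x := (N : ℝ)) (k := j + 1) (y := 2 * (c + 1 : ℕ)) h3
  omega

end LogStar

/-! ### Edge labels from Cole–Vishkin colorings of forests -/

section EdgeLabel

variable {N h : ℕ} {E : ℕ → ℕ → Prop}

open Classical in
/-- The heads of the edges with tail `u`. -/
noncomputable def upSet (N : ℕ) (E : ℕ → ℕ → Prop) (u : ℕ) : Finset ℕ :=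
  (Finset.range N).filter fun v => E u v

/-- The position of `v` in an enumeration of a finite set. -/
noncomputable def finsetIndex (A : Finset ℕ) (v : ℕ) : ℕ :=
  if h : v ∈ A then A.equivFin ⟨v, h⟩ else 0

theorem finsetIndex_inj {A : Finset ℕ} {v w : ℕ} (hv : v ∈ A) (hw : w ∈ A)
    (h : finsetIndex A v = finsetIndex A w) : v = w := by
  rw [finsetIndex, finsetIndex, dif_pos hv, dif_pos hw] at h
  exact congrArg Subtype.val (A.equivFin.injective (Fin.ext h))

theorem finsetIndex_lt {A : Finset ℕ} {c : ℕ} (hA : A.card ≤ c) (hc : 0 < c) (v : ℕ) :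
    finsetIndex A v < c := by
  unfold finsetIndex
  split_ifs with h
  · exact (A.equivFin ⟨v, h⟩).2.trans_le hA
  · exact hc

open Classical in
/-- The parent of `u` in the forest that consists of the `i`-th outgoing edge of each vertex; a
root counts as its own parent. -/
noncomputable def forestParent (N : ℕ) (E : ℕ → ℕ → Prop) (i u : ℕ) : ℕ :=
  if h : ∃ v ∈ upSet N E u, finsetIndex (upSet N E u) v = i then h.choose else u

/-- The colors of the vertices in the forests, after some color reductions. -/
noncomputable def forestColor (N : ℕ) (E : ℕ → ℕ → Prop) : ℕ → ℕ → ℕ → ℕ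
  | 0, _, u => if u < N then u else 0
  | t + 1, i, u => bitColor (forestColor N E t i u) (forestColor N E t i (forestParent N E i u))

/-- The label of an edge: the number of its forest and the color of its tail there. -/
noncomputable def edgeLabel (N : ℕ) (E : ℕ → ℕ → Prop) (t u v : ℕ) : ℕ :=
  32 * finsetIndex (upSet N E u) v + forestColor N E t (finsetIndex (upSet N E u) v) u

theorem forestParent_eq (hE : ∀ u v, E u v → u < N ∧ v < N) {u v : ℕ} (huv : E u v) :
    forestParent N E (finsetIndex (upSet N E u) v) u = v := by
  have hv : v ∈ upSet N E u := by simp [upSet, huv, (hE u v huv).2]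
  have hex : ∃ v' ∈ upSet N E u, finsetIndex (upSet N E u) v' = finsetIndex (upSet N E u) v :=
    ⟨v, hv, rfl⟩
  rw [forestParent, dif_pos hex]
  exact finsetIndex_inj hex.choose_spec.1 hv hex.choose_spec.2

theorem forestColor_ne (hE : ∀ u v, E u v → u < N ∧ v < N) (hlt : ∀ u v, E u v → u < v)
    {u v : ℕ} (huv : E u v) (t : ℕ) :
    forestColor N E t (finsetIndex (upSet N E u) v) u ≠
      forestColor N E t (finsetIndex (upSet N E u) v) v := by
  induction t with
  | zero =>
    simp only [forestColor, (hE u v huv).1, (hE u v huv).2, if_true]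
    exact (hlt u v huv).ne
  | succ t ih =>
    simp only [forestColor, forestParent_eq hE huv]
    exact bitColor_ne ih _

/-- A reduction takes colors below `2 ^ m` to colors below `2 * m`; the affine bound is chosen to
absorb the rounding of the logarithm. -/
theorem forestColor_lt {t : ℕ} (ht : t ≤ logStar (N : ℝ)) :
    ∀ i u, (forestColor N E t i u : ℝ) < 4 * (Real.logb 2)^[t] N + 16 := by
  induction t with
  | zero =>
    intro i u
    simp only [forestColor, Function.iterate_zero, id]
    have hN : (0 : ℝ) ≤ N := Nat.cast_nonneg N
    split_ifs with h
    · have : (u : ℝ) < N := by exact_mod_cast h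
      linarith
    · push_cast; linarith
  | succ t ih =>
    intro i u
    have ih := ih (by omega)
    set x := (Real.logb 2)^[t] (N : ℝ) with hx
    have hx1 : 1 < x := one_lt_iterate ht
    have hlog : 0 < Real.logb 2 x := Real.logb_pos (by norm_num) hx1
    rw [Function.iterate_succ_apply', ← hx]
    -- As `x > 1`, `4 * x + 16` is less than `32 * 2 ^ (⌊log x⌋ + 1)`. In turn `2 * m ≤ 2 * log x +
    -- 12` is below the next bound.
    set m := ⌊Real.logb 2 x⌋₊ + 6 with hm
    have hm1 : Real.logb 2 x < (⌊Real.logb 2 x⌋₊ : ℝ) + 1 := Nat.lt_floor_add_one _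
    have hm2 : (⌊Real.logb 2 x⌋₊ : ℝ) ≤ Real.logb 2 x := Nat.floor_le hlog.le
    have hpow : 4 * x + 16 ≤ (2 : ℝ) ^ m := by
      have h1 : x < (2 : ℝ) ^ (⌊Real.logb 2 x⌋₊ + 1) := by
        rw [Real.logb_lt_iff_lt_rpow (by norm_num) (by linarith)] at hm1
        rw [← Real.rpow_natCast]
        push_cast
        exact hm1
      rw [hm, show ⌊Real.logb 2 x⌋₊ + 6 = ⌊Real.logb 2 x⌋₊ + 1 + 5 by ring, pow_add]
      nlinarith
    have hc : ∀ u, forestColor N E t i u < 2 ^ m := by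
      intro u
      have : (forestColor N E t i u : ℝ) < 2 ^ m := (ih i u).trans_le hpow
      exact_mod_cast this
    have h2 := bitColor_lt (m := m) (by omega) (hc u) (hc (forestParent N E i u))
    have h3 : (forestColor N E (t + 1) i u : ℝ) < 2 * m := by exact_mod_cast h2
    rw [hm] at h3
    push_cast at h3
    linarith

/-- The final bound is `4 * 1 + 16`; `32` is a convenient power of two, which accounts for five bits
of an edge label. -/
theorem forestColor_lt_of_logStar (i u : ℕ) : forestColor N E (logStar (N : ℝ)) i u < 32 := by
  have h2 := forestColor_lt (N := N) (E := E) (t := logStar (N : ℝ)) le_rfl i u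
  have h3 := iterate_logStar_le (N : ℝ)
  have h4 : (forestColor N E (logStar (N : ℝ)) i u : ℝ) < (32 : ℕ) := by push_cast; linarith
  exact_mod_cast h4

theorem edgeLabel_lt (hcard : ∀ u, (upSet N E u).card ≤ 2 ^ h) (u v : ℕ) :
    edgeLabel N E (logStar (N : ℝ)) u v < 2 ^ (h + 5) := by
  have h1 := finsetIndex_lt (hcard u) (by positivity) v
  have h2 := forestColor_lt_of_logStar (N := N) (E := E) (finsetIndex (upSet N E u) v) u
  rw [edgeLabel, pow_add]
  omega

/-- Equal labels would put both edges into one forest, where `v` is the parent of `u` and so has a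
different color. -/
theorem edgeLabel_ne (hE : ∀ u v, E u v → u < N ∧ v < N) (hlt : ∀ u v, E u v → u < v)
    {u v x : ℕ} (huv : E u v) :
    edgeLabel N E (logStar (N : ℝ)) u v ≠ edgeLabel N E (logStar (N : ℝ)) v x := by
  intro h
  unfold edgeLabel at h
  have h1 := forestColor_lt_of_logStar (N := N) (E := E) (finsetIndex (upSet N E u) v) u
  have h2 := forestColor_lt_of_logStar (N := N) (E := E) (finsetIndex (upSet N E v) x) v
  have h3 : finsetIndex (upSet N E u) v = finsetIndex (upSet N E v) x := by omega
  rw [← h3] at h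
  exact forestColor_ne hE hlt huv (logStar (N : ℝ)) (by omega)

theorem goodEdges_edgeLabel (hE : ∀ u v, E u v → u < N ∧ v < N) (hlt : ∀ u v, E u v → u < v)
    (ho : ∀ u, (upSet N E u).card ≤ 2 ^ h) (hi : ∀ v, (upSet N (fun v u => E u v) v).card ≤ 2 ^ h) :
    GoodEdges N h (edgeLabel N E (logStar (N : ℝ))) E :=
  ⟨hlt, hE, ho, hi, fun _ _ _ huv _ => edgeLabel_ne hE hlt huv⟩

end EdgeLabel

/-! ### How far each phase looks -/

section Locality

/-- Two graphs look the same from `v` up to distance `T`. -/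
def Agree (H H' : SimpleGraph ℕ) : ℕ → ℕ → Prop
  | 0, _ => True
  | T + 1, v => Agree H H' T v ∧ (∀ u, H.Adj v u ↔ H'.Adj v u) ∧ ∀ u, H.Adj v u → Agree H H' T u

/-- Two labelings of the vertices are equal where the graphs look the same up to distance `T`. -/
def VertexAgree {S : Type*} (H H' : SimpleGraph ℕ) (T : ℕ) (x x' : ℕ → S) : Prop :=
  ∀ u, Agree H H' T u → x u = x' u

/-- Two labelings of the pairs of vertices are equal at the pairs with an element where the graphs
look the same up to distance `T`. -/
def EdgeAgree {S : Type*} (H H' : SimpleGraph ℕ) (T : ℕ) (X X' : ℕ → ℕ → S) : Prop :=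
  ∀ u, Agree H H' T u → ∀ v, X u v = X' u v ∧ X v u = X' v u

variable {S S' : Type*} {H H' : SimpleGraph ℕ} {T T' : ℕ}

theorem Agree.mono (hT : T ≤ T') {v : ℕ} (h : Agree H H' T' v) : Agree H H' T v := by
  induction hT with
  | refl => exact h
  | step _ ih => exact ih h.1

theorem VertexAgree.mono {x x' : ℕ → S} (h : VertexAgree H H' T x x') (hT : T ≤ T') :
    VertexAgree H H' T' x x' := fun u hu => h u (hu.mono hT)

theorem EdgeAgree.mono {X X' : ℕ → ℕ → S} (h : EdgeAgree H H' T X X') (hT : T ≤ T') :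
    EdgeAgree H H' T' X X' := fun u hu => h u (hu.mono hT)

theorem EdgeAgree.map {X X' : ℕ → ℕ → S} (h : EdgeAgree H H' T X X') (f : S → S') :
    EdgeAgree H H' T (fun u v => f (X u v)) (fun u v => f (X' u v)) := fun u hu v =>
  ⟨congrArg f (h u hu v).1, congrArg f (h u hu v).2⟩

theorem EdgeAgree.out {X X' : ℕ → ℕ → S} (h : EdgeAgree H H' T X X') : VertexAgree H H' T X X' :=
  fun u hu => funext fun v => (h u hu v).1

theorem EdgeAgree.in {X X' : ℕ → ℕ → S} (h : EdgeAgree H H' T X X') :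
    VertexAgree H H' T (fun v u => X u v) (fun v u => X' u v) :=
  fun u hu => funext fun v => (h u hu v).2

theorem VertexAgree.map {x x' : ℕ → S} (h : VertexAgree H H' T x x') (f : S → S') :
    VertexAgree H H' T (fun u => f (x u)) (fun u => f (x' u)) := fun u hu => congrArg f (h u hu)

/-- The value at an edge is computed from data at both ends, so each such step costs one unit of
distance. Values off both graphs are constant by `hsupp`. -/
theorem edgeAgree_succ {X X' : ℕ → ℕ → S}
    (hsupp : ∀ u v, ¬ H.Adj u v → ¬ H'.Adj u v → X u v = X' u v)
    (hstep : ∀ u v, Agree H H' T u → Agree H H' T v → X u v = X' u v) :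
    EdgeAgree H H' (T + 1) X X' := by
  intro u hu v
  by_cases huv : H.Adj u v
  · exact ⟨hstep u v hu.1 (hu.2.2 v huv), hstep v u (hu.2.2 v huv) hu.1⟩
  · have huv' : ¬ H'.Adj u v := fun h => huv ((hu.2.1 v).2 h)
    exact ⟨hsupp u v huv huv', hsupp v u (fun h => huv h.symm) fun h => huv' h.symm⟩

theorem vertexAgree_touched {M M' : ℕ → ℕ → Prop} (h : EdgeAgree H H' T M M') :
    VertexAgree H H' T (Touched M) (Touched M') := by
  intro u hu
  unfold Touched
  simp only [(h u hu _).1, (h u hu _).2]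

theorem edgeAgree_remaining {E E' M M' : ℕ → ℕ → Prop} (hE : EdgeAgree H H' T E E')
    (hEH : ∀ u v, E u v → H.Adj u v) (hEH' : ∀ u v, E' u v → H'.Adj u v)
    (hM : EdgeAgree H H' T M M') : EdgeAgree H H' (T + 1) (remaining E M) (remaining E' M') := by
  refine edgeAgree_succ (fun u v h h' => ?_) fun u v hu hv => ?_
  · exact propext ⟨fun hr => (h (hEH _ _ hr.1)).elim, fun hr => (h' (hEH' _ _ hr.1)).elim⟩
  · unfold remaining
    rw [(hE u hu v).1, vertexAgree_touched hM u hu, vertexAgree_touched hM v hv]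

/-- The support of the weights lies in the graph. -/
def Supported (H : SimpleGraph ℕ) (w : ℕ → ℕ → ℕ) : Prop := ∀ u v, ¬ H.Adj u v → w u v = 0

variable {N h r i m : ℕ} {w w' : ℕ → ℕ → ℕ}

theorem vertexAgree_outSum (hw : EdgeAgree H H' T w w') :
    VertexAgree H H' T (outSum N w) (outSum N w') :=
  hw.out.map fun f => ∑ v ∈ Finset.range N, f v

theorem vertexAgree_inSum (hw : EdgeAgree H H' T w w') :
    VertexAgree H H' T (inSum N w) (inSum N w') :=
  hw.in.map fun f => ∑ u ∈ Finset.range N, f u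

theorem Supported.growStep (hw : Supported H w) : Supported H (growStep N h w) := fun u v huv => by
  have := growStep_le (N := N) (h := h) w u v
  rw [hw u v huv] at this
  omega

theorem edgeAgree_growStep (hw : EdgeAgree H H' T w w') (hs : Supported H w)
    (hs' : Supported H' w') : EdgeAgree H H' (T + 1) (growStep N h w) (growStep N h w') := by
  refine edgeAgree_succ (fun u v h h' => ?_) fun u v hu hv => ?_
  · rw [hs.growStep u v h, hs'.growStep u v h']
  · unfold growStep
    rw [(hw u hu v).1, vertexAgree_outSum hw u hu, vertexAgree_inSum hw v hv]

variable {E E' : ℕ → ℕ → Prop}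

theorem supported_growWeights (hE : ∀ u v, E u v → H.Adj u v) (t : ℕ) :
    Supported H (growWeights N h E t) := by
  induction t with
  | zero => exact fun u v huv => if_neg fun h => huv (hE u v h)
  | succ t ih => exact ih.growStep

theorem edgeAgree_growWeights (hE : EdgeAgree H H' T E E') (hEH : ∀ u v, E u v → H.Adj u v)
    (hEH' : ∀ u v, E' u v → H'.Adj u v) (t : ℕ) :
    EdgeAgree H H' (T + t) (growWeights N h E t) (growWeights N h E' t) := by
  classical
  induction t with
  | zero =>
    intro u hu v
    simp only [growWeights, unitWeights, (hE u hu v).1, (hE u hu v).2, and_self]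
  | succ t ih =>
    exact edgeAgree_growStep ih (supported_growWeights hEH t) (supported_growWeights hEH' t)

theorem vertexAgree_outSet (hw : EdgeAgree H H' T w w') :
    VertexAgree H H' T (outSet N w i) (outSet N w' i) :=
  hw.out.map fun f => (Finset.range N).filter fun v => f v = 2 ^ i

theorem vertexAgree_inSet (hw : EdgeAgree H H' T w w') :
    VertexAgree H H' T (inSet N w i) (inSet N w' i) :=
  hw.in.map fun f => (Finset.range N).filter fun u => f u = 2 ^ i

theorem tailMate_eq (hw : EdgeAgree H H' T w w') {u : ℕ} (hu : Agree H H' T u) (v : ℕ) :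
    tailMate N w i (u, v) = tailMate N w' i (u, v) := by
  simp only [tailMate, vertexAgree_outSet hw u hu]

theorem headMate_eq (hw : EdgeAgree H H' T w w') {v : ℕ} (hv : Agree H H' T v) (u : ℕ) :
    headMate N w i (u, v) = headMate N w' i (u, v) := by
  simp only [headMate, vertexAgree_inSet hw v hv]

theorem tailMate_of_eq_zero {u v : ℕ} (h : w u v = 0) : tailMate N w i (u, v) = (u, v) := by
  have : v ∉ outSet N w i u := fun hv => by
    have := (Finset.mem_filter.1 hv).2
    rw [h] at this
    exact absurd this (by positivity)
  simp only [tailMate, pairing_of_notMem this]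

theorem headMate_of_eq_zero {u v : ℕ} (h : w u v = 0) : headMate N w i (u, v) = (u, v) := by
  have : u ∉ inSet N w i v := fun hv => by
    have := (Finset.mem_filter.1 hv).2
    rw [h] at this
    exact absurd this (by positivity)
  simp only [headMate, pairing_of_notMem this]

/-- The largest label that a flag of the edge `(u, v)` sees within distance `n`. -/
noncomputable def edgeSegMax (N i : ℕ) (w : ℕ → ℕ → ℕ) (n u v : ℕ) (d : Bool) : ℕ ×ₗ ℕ :=
  segMax (flagStep (tailMate N w i) (headMate N w i)) flagFlip
    (flagLabel (headMate N w i) fun e => Nat.pair e.1 e.2) n ((u, v), d)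

theorem edgeSegMax_eq_of_eq_zero {u v : ℕ} (h : w u v = 0) (h' : w' u v = 0) (n : ℕ) :
    edgeSegMax N i w n u v = edgeSegMax N i w' n u v := by
  have key : ∀ w : ℕ → ℕ → ℕ, w u v = 0 → ∀ d, edgeSegMax N i w n u v d =
      flagLabel (headMate N w i) (fun e => Nat.pair e.1 e.2) ((u, v), d) := by
    intro w h d
    cases n with
    | zero => rfl
    | succ n =>
      rw [edgeSegMax, segMax, if_pos]
      cases d <;> simp [flagStep, flagFlip, tailMate_of_eq_zero h, headMate_of_eq_zero h]
  funext d
  rw [key w h, key w' h']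
  simp only [flagLabel, headMate_of_eq_zero h, headMate_of_eq_zero h']

theorem edgeAgree_edgeSegMax (hw : EdgeAgree H H' T w w') (hs : Supported H w)
    (hs' : Supported H' w') (n : ℕ) :
    EdgeAgree H H' (T + 1 + n) (edgeSegMax N i w n) (edgeSegMax N i w' n) := by
  have hlab : ∀ u v, Agree H H' T u → Agree H H' T v → ∀ d,
      flagLabel (headMate N w i) (fun e => Nat.pair e.1 e.2) ((u, v), d) =
      flagLabel (headMate N w' i) (fun e => Nat.pair e.1 e.2) ((u, v), d) := by
    intro u v _ hv d
    simp only [flagLabel, headMate_eq hw hv]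
    congr
  induction n with
  | zero =>
    refine edgeAgree_succ (fun u v h h' => edgeSegMax_eq_of_eq_zero (hs u v h) (hs' u v h') 0) ?_
    exact fun u v hu hv => funext fun d => hlab u v hu hv d
  | succ n ih =>
    refine edgeAgree_succ
      (fun u v h h' => edgeSegMax_eq_of_eq_zero (hs u v h) (hs' u v h') (n + 1)) ?_
    intro u v hu hv
    funext d
    have hu' := hu.mono (show T ≤ T + 1 + n by omega)
    have hv' := hv.mono (show T ≤ T + 1 + n by omega)
    have hl := hlab u v hu' hv' d
    have hstep : flagStep (tailMate N w i) (headMate N w i) ((u, v), d) =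
        flagStep (tailMate N w' i) (headMate N w' i) ((u, v), d) := by
      simp only [flagStep, tailMate_eq hw hu', headMate_eq hw hv']
    have hrec : segMax (flagStep (tailMate N w i) (headMate N w i)) flagFlip
          (flagLabel (headMate N w i) fun e => Nat.pair e.1 e.2) n
          (flagStep (tailMate N w' i) (headMate N w' i) ((u, v), d)) =
        segMax (flagStep (tailMate N w' i) (headMate N w' i)) flagFlip
          (flagLabel (headMate N w' i) fun e => Nat.pair e.1 e.2) n
          (flagStep (tailMate N w' i) (headMate N w' i) ((u, v), d)) := by
      -- The mate at the tail shares `u`, the mate at the head shares `v`, so the induction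
      -- hypothesis applies at the common vertex.
      cases d
      · exact congrFun (ih u hu _).1 true
      · exact congrFun (ih v hv _).2 false
    simp only [edgeSegMax, segMax]
    rw [hstep, hrec, hl]

theorem splitSel_iff (e : ℕ × ℕ) :
    SplitSel (tailMate N w i) (headMate N w i) (fun e => Nat.pair e.1 e.2) r e ↔
      edgeSegMax N i w r e.1 e.2 false < edgeSegMax N i w r e.1 e.2 true := Iff.rfl

/-- One unit is for the label of an edge, `r` are for the walk, and one is for comparing with the
mates. -/
theorem edgeAgree_roundStep (hw : EdgeAgree H H' T w w') (hs : Supported H w)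
    (hs' : Supported H' w') :
    EdgeAgree H H' (T + (r + 2)) (roundStep N r i w) (roundStep N r i w') := by
  have hseg := edgeAgree_edgeSegMax (N := N) (i := i) hw hs hs' r
  rw [show T + (r + 2) = T + 1 + r + 1 by ring]
  refine edgeAgree_succ (fun u v h h' => ?_) fun u v hu hv => ?_
  · rw [roundStep_eq_zero u v (hs u v h), roundStep_eq_zero u v (hs' u v h')]
  · have hu' := hu.mono (show T ≤ T + 1 + r by omega)
    have hv' := hv.mono (show T ≤ T + 1 + r by omega)
    have hsel : ∀ x y, (x = u ∨ y = v) →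
        (SplitSel (tailMate N w i) (headMate N w i) (fun e => Nat.pair e.1 e.2) r (x, y) ↔
        SplitSel (tailMate N w' i) (headMate N w' i) (fun e => Nat.pair e.1 e.2) r (x, y)) := by
      intro x y hxy
      have : edgeSegMax N i w r x y = edgeSegMax N i w' r x y := by
        rcases hxy with rfl | rfl
        · exact (hseg x hu y).1
        · exact (hseg y hv x).2
      rw [splitSel_iff, splitSel_iff, this]
    have hR : RoundUp N r i w u v ↔ RoundUp N r i w' u v := by
      unfold RoundUp SplitKeep
      rw [tailMate_eq hw hu', headMate_eq hw hv', hsel u v (Or.inl rfl),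
        hsel _ _ (Or.inl (show (tailMate N w' i (u, v)).1 = u from rfl)),
        hsel _ _ (Or.inr (show (headMate N w' i (u, v)).2 = v from rfl))]
    unfold roundStep
    rw [(hw u hu' v).1]
    split_ifs <;> tauto

theorem Supported.roundStep (hs : Supported H w) : Supported H (roundStep N r i w) :=
  fun u v huv => roundStep_eq_zero u v (hs u v huv)

theorem Supported.roundWeights (hs : Supported H w) (i : ℕ) :
    Supported H (roundWeights N r w i) := by
  induction i with
  | zero => exact hs
  | succ i ih => exact ih.roundStep

theorem edgeAgree_roundWeights (hw : EdgeAgree H H' T w w') (hs : Supported H w)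
    (hs' : Supported H' w') (i : ℕ) :
    EdgeAgree H H' (T + i * (r + 2)) (roundWeights N r w i) (roundWeights N r w' i) := by
  induction i with
  | zero => exact hw.mono (Nat.le_add_right _ _)
  | succ i ih =>
    rw [Nat.succ_mul, ← add_assoc]
    exact edgeAgree_roundStep ih (hs.roundWeights i) (hs'.roundWeights i)

theorem edgeAgree_roundedEdges (hE : EdgeAgree H H' T E E') (hEH : ∀ u v, E u v → H.Adj u v)
    (hEH' : ∀ u v, E' u v → H'.Adj u v) :
    EdgeAgree H H' (T + h + h * (4 * h - 1 + 2)) (roundedEdges N h E) (roundedEdges N h E') :=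
  (edgeAgree_roundWeights (edgeAgree_growWeights hE hEH hEH' h) (supported_growWeights hEH h)
    (supported_growWeights hEH' h) h).map fun x => x = 2 ^ h

theorem adj_of_roundedEdges (hEH : ∀ u v, E u v → H.Adj u v) {u v : ℕ}
    (huv : roundedEdges N h E u v) : H.Adj u v := by
  by_contra hcon
  have h1 : 0 = 2 ^ h :=
    ((supported_growWeights hEH h).roundWeights h u v hcon).symm.trans huv
  exact absurd h1 (by positivity)

open Classical in
theorem nextLabel_congr {F F' : ℕ → ℕ → Prop} {κ κ' : ℕ → ℕ → ℕ} {v : ℕ} (hF : F v = F' v)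
    (hκ : κ v = κ' v) (d : ℕ) : nextLabel F κ d v = nextLabel F' κ' d v := by
  -- Equal predicates give the same chosen witness.
  let g : (ℕ → Prop) → (ℕ → ℕ) → ℕ := fun P k => if h : ∃ x, P x then k h.choose else d
  exact congrArg₂ g hF hκ

theorem edgeAgree_greedy {F F' : ℕ → ℕ → Prop} {ξ ξ' : ℕ → ℕ → ℕ} (hF : EdgeAgree H H' T F F')
    (hFH : ∀ u v, F u v → H.Adj u v) (hFH' : ∀ u v, F' u v → H'.Adj u v)
    (hξ : ∀ u v, Agree H H' T u → Agree H H' T v → ξ u v = ξ' u v) (j : ℕ) :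
    EdgeAgree H H' (T + j) (greedy F ξ j) (greedy F' ξ' j) := by
  induction j with
  | zero => exact fun u _ v => ⟨rfl, rfl⟩
  | succ j ih =>
    refine edgeAgree_succ (fun u v h h' => ?_) fun u v hu hv => ?_
    · exact propext ⟨fun hg => (h (hFH _ _ (greedy_le (j + 1) _ _ hg))).elim,
        fun hg => (h' (hFH' _ _ (greedy_le (j + 1) _ _ hg))).elim⟩
    · have hu' := hu.mono (Nat.le_add_right T j)
      have hv' := hv.mono (Nat.le_add_right T j)
      simp only [greedy]
      rw [(ih u hu v).1, (hF u hu' v).1, hξ u v hu' hv', vertexAgree_touched ih u hu,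
        vertexAgree_touched ih v hv]

theorem edgeAgree_constMatching {κ κ' : ℕ → ℕ → ℕ} (hκ : VertexAgree H H' T κ κ')
    (hE : EdgeAgree H H' T E E') (hEH : ∀ u v, E u v → H.Adj u v)
    (hEH' : ∀ u v, E' u v → H'.Adj u v) :
    EdgeAgree H H' (T + (h + h * (4 * h - 1 + 2) + 2 * m)) (constMatching N h m κ E)
      (constMatching N h m κ' E') := by
  have hR := edgeAgree_roundedEdges (N := N) (h := h) hE hEH hEH'
  have hκ' := hκ.mono (show T ≤ T + h + h * (4 * h - 1 + 2) by omega)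
  rw [← add_assoc, ← add_assoc]
  refine edgeAgree_greedy hR (fun _ _ => adj_of_roundedEdges hEH)
    (fun _ _ => adj_of_roundedEdges hEH') (fun u v hu hv => ?_) (2 * m)
  unfold edgeClass
  rw [hκ' u hu, nextLabel_congr (hR.out v hv) (hκ' v hv)]

theorem edgeAgree_iterMatching {κ κ' : ℕ → ℕ → ℕ} (hκ : VertexAgree H H' T κ κ')
    (hE : EdgeAgree H H' T E E') (hEH : ∀ u v, E u v → H.Adj u v)
    (hEH' : ∀ u v, E' u v → H'.Adj u v) (s : ℕ) :
    EdgeAgree H H' (T + s * (1 + (h + h * (4 * h - 1 + 2) + 2 * m))) (iterMatching N h m κ E s)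
      (iterMatching N h m κ' E' s) := by
  induction s with
  | zero => exact fun u _ v => ⟨rfl, rfl⟩
  | succ s ih =>
    rw [Nat.succ_mul, ← add_assoc]
    set T₁ := T + s * (1 + (h + h * (4 * h - 1 + 2) + 2 * m)) with hT₁
    have hle : T ≤ T₁ := Nat.le_add_right _ _
    have h1 := edgeAgree_remaining (hE.mono hle) hEH hEH' ih
    have h2 := edgeAgree_constMatching (N := N) (h := h) (m := m)
      (hκ.mono (hle.trans (Nat.le_succ _))) h1 (fun u v huv => hEH u v huv.1)
      (fun u v huv => hEH' u v huv.1)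
    have h3 := ih.mono (show T₁ ≤ T₁ + (1 + (h + h * (4 * h - 1 + 2) + 2 * m)) by omega)
    rw [show T₁.succ + (h + h * (4 * h - 1 + 2) + 2 * m) =
      T₁ + (1 + (h + h * (4 * h - 1 + 2) + 2 * m)) by omega] at h2
    intro u hu v
    simp only [iterMatching]
    exact ⟨by rw [(h3 u hu v).1, (h2 u hu v).1], by rw [(h3 u hu v).2, (h2 u hu v).2]⟩

/-- The edges of a graph on the natural numbers, directed to the larger endpoint. -/
def upEdges (H : SimpleGraph ℕ) (u v : ℕ) : Prop := H.Adj u v ∧ u < v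

theorem edgeAgree_upEdges : EdgeAgree H H' 1 (upEdges H) (upEdges H') := by
  intro u hu v
  unfold upEdges
  rw [H.adj_comm v u, H'.adj_comm v u, hu.2.1 v]
  exact ⟨rfl, rfl⟩

theorem forestParent_eq_or (i u : ℕ) : forestParent N E i u = u ∨ E u (forestParent N E i u) := by
  classical
  unfold forestParent
  split_ifs with h
  · exact Or.inr (Finset.mem_filter.1 h.choose_spec.1).2
  · exact Or.inl rfl

theorem upSet_congr {u : ℕ} (h : E u = E' u) : upSet N E u = upSet N E' u := by
  unfold upSet; rw [h]

theorem vertexAgree_forestColor (hE : EdgeAgree H H' T E E') (hEH : ∀ u v, E u v → H.Adj u v)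
    (t : ℕ) : VertexAgree H H' (T + t) (fun u i => forestColor N E t i u)
      (fun u i => forestColor N E' t i u) := by
  induction t with
  | zero => exact fun u _ => rfl
  | succ t ih =>
    intro u hu
    funext i
    have hp : forestParent N E i u = forestParent N E' i u := by
      unfold forestParent
      rw [upSet_congr (hE.out u (hu.mono (by omega)))]
    have hu' : Agree H H' (T + t) (forestParent N E i u) := by
      rcases forestParent_eq_or (N := N) (E := E) i u with h | h
      · rw [h]; exact hu.mono (by omega)
      · exact hu.2.2 _ (hEH _ _ h)
    have h1 : forestColor N E t i u = forestColor N E' t i u :=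
      congrFun (ih u (hu.mono (by omega))) i
    have h2 : forestColor N E t i (forestParent N E i u) =
      forestColor N E' t i (forestParent N E i u) := congrFun (ih _ hu') i
    simp only [forestColor]
    rw [← hp, h1, h2]

theorem vertexAgree_edgeLabel (hE : EdgeAgree H H' T E E') (hEH : ∀ u v, E u v → H.Adj u v)
    (t : ℕ) : VertexAgree H H' (T + t) (edgeLabel N E t) (edgeLabel N E' t) := by
  intro u hu
  funext v
  have h1 : ∀ i, forestColor N E t i u = forestColor N E' t i u :=
    congrFun (vertexAgree_forestColor (N := N) hE hEH t u hu)
  unfold edgeLabel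
  rw [upSet_congr (hE.out u (hu.mono (by omega))), h1]

/-- The matching that is computed on a graph. -/
noncomputable def graphMatching (N h s : ℕ) (H : SimpleGraph ℕ) : ℕ → ℕ → Prop :=
  iterMatching N h (h + 5) (edgeLabel N (upEdges H) (logStar (N : ℝ))) (upEdges H) s

/-- The distance up to which the matching depends on the graph. -/
noncomputable def radius (N h s : ℕ) : ℕ :=
  1 + logStar (N : ℝ) + s * (1 + (h + h * (4 * h - 1 + 2) + 2 * (h + 5)))

theorem edgeAgree_graphMatching (N h s : ℕ) :
    EdgeAgree H H' (radius N h s) (graphMatching N h s H) (graphMatching N h s H') :=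
  edgeAgree_iterMatching (vertexAgree_edgeLabel edgeAgree_upEdges (fun _ _ h => h.1) _)
    (edgeAgree_upEdges.mono (by omega)) (fun _ _ h => h.1) (fun _ _ h => h.1) s

end Locality

/-! ### Collecting the ball in the `LOCAL` model and reading off the output -/

section Simulation

/-- What a node knows during the collection of the surrounding graph. -/
structure GatherState where
  /-- the common knowledge -/
  know : Knowledge
  /-- the own identifier -/
  ident : ℕ
  /-- the number of rounds that have passed -/
  time : ℕ
  /-- the identifiers of the neighbors behind the ports -/
  names : ℕ → ℕ
  /-- the known edges -/
  edges : Set (ℕ × ℕ)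

/-- The graph of the known edges. -/
def knownGraph (S : Set (ℕ × ℕ)) : SimpleGraph ℕ := SimpleGraph.fromRel fun a b => (a, b) ∈ S

/-- An upper bound on the logarithm of the maximum degree. -/
noncomputable def degreeBits (k L : ℝ) : ℕ := ⌈k * L⌉₊

/-- The number of iterations of the matching algorithm. -/
noncomputable def iterCount (ε : ℝ) : ℕ := 22 * (⌈max 1 (Real.logb 2 (1 / ε))⌉₊ + 2)

/-- The number of rounds. -/
noncomputable def roundCount (k : ℝ) (κ : Knowledge) : ℕ :=
  radius κ.idBound (degreeBits k κ.logDegree) (iterCount κ.eps)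

/-- The matching that a node computes from the graph that it knows. -/
noncomputable def knownMatching (k : ℝ) (κ : Knowledge) (H : SimpleGraph ℕ) : ℕ → ℕ → Prop :=
  graphMatching κ.idBound (degreeBits k κ.logDegree) (iterCount κ.eps) H

open Classical in
/-- The algorithm collects the surrounding graph and computes the matching there. If the
maximum degree is at most one, all edges are matched without any communication. -/
noncomputable def gatherAlgorithm (k : ℝ) : LocalAlgorithm Knowledge MatchOutput where
  State := GatherState
  Msg := ℕ × Set (ℕ × ℕ)
  init κ i _ := ⟨κ, i, 0, fun _ => 0, ∅⟩
  send _ st _ := (st.ident, st.edges)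
  recv d st msg := ⟨st.know, st.ident, st.time + 1,
    fun p => if h : p < d then (msg ⟨p, h⟩).1 else 0,
    st.edges ∪ {e | ∃ p, e = (st.ident, (msg p).1) ∨ e ∈ (msg p).2}⟩
  output d st :=
    if st.know.logDegree ≤ 0 then some (if h : 0 < d then some ⟨0, h⟩ else none)
    else if st.time = roundCount k st.know then
      some (if h : ∃ p : Fin d,
          knownMatching k st.know (knownGraph st.edges) st.ident (st.names p) ∨
          knownMatching k st.know (knownGraph st.edges) (st.names p) st.ident
        then some h.choose else none)
    else none

variable {V : Type*} [Fintype V] {G : SimpleGraph V} [DecidableRel G.Adj] (net : Network G)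

/-- The graph of a network on the identifiers. -/
def netGraph : SimpleGraph ℕ := G.map net.id

theorem netGraph_adj {a b : ℕ} :
    (netGraph net).Adj a b ↔ ∃ u v, G.Adj u v ∧ net.id u = a ∧ net.id v = b :=
  SimpleGraph.map_adj ⟨net.id, net.id_injective⟩ G a b

theorem netGraph_adj_id {u v : V} : (netGraph net).Adj (net.id u) (net.id v) ↔ G.Adj u v := by
  rw [netGraph_adj]
  constructor
  · rintro ⟨u', v', h, hu, hv⟩
    rwa [net.id_injective hu, net.id_injective hv] at h
  · exact fun h => ⟨u, v, h, rfl, rfl⟩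

theorem Network.adj_nbr (v : V) (p : Fin (G.degree v)) : G.Adj v (net.nbr v p) := (net.port v p).2

theorem Network.exists_nbr_eq {v w : V} (h : G.Adj v w) : ∃ p, net.nbr v p = w :=
  ⟨(net.port v).symm ⟨w, h⟩, by simp [Network.nbr]⟩

theorem Agree.of_le {H K K' : SimpleGraph ℕ} (h1 : K ≤ K') (h2 : K' ≤ H) {t v : ℕ}
    (h : Agree H K t v) : Agree H K' t v := by
  induction t generalizing v with
  | zero => trivial
  | succ t ih =>
    exact ⟨ih h.1, fun u => ⟨fun hu => h1 ((h.2.1 u).1 hu), fun hu => h2 hu⟩,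
      fun u hu => ih (h.2.2 u hu)⟩

/-- The states of the nodes if no node terminates. -/
noncomputable def gatherState (k : ℝ) (κ : Knowledge) : ℕ → V → GatherState
  | 0, v => (gatherAlgorithm k).init κ (net.id v) (G.degree v)
  | t + 1, v => (gatherAlgorithm k).recv (G.degree v) (gatherState k κ t v) fun p =>
      (gatherAlgorithm k).send (G.degree (net.nbr v p)) (gatherState k κ t (net.nbr v p))
        (net.backPort v p)

variable (k : ℝ) (κ : Knowledge)

theorem gatherState_know (t : ℕ) (v : V) : (gatherState net k κ t v).know = κ := by
  induction t with
  | zero => rfl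
  | succ t ih => exact ih

theorem gatherState_ident (t : ℕ) (v : V) : (gatherState net k κ t v).ident = net.id v := by
  induction t with
  | zero => rfl
  | succ t ih => exact ih

theorem gatherState_time (t : ℕ) (v : V) : (gatherState net k κ t v).time = t := by
  induction t with
  | zero => rfl
  | succ t ih => exact congrArg (· + 1) ih

theorem gatherState_names (t : ℕ) (v : V) (p : Fin (G.degree v)) :
    (gatherState net k κ (t + 1) v).names p = net.id (net.nbr v p) := by
  simp [gatherState, gatherAlgorithm, gatherState_ident]

theorem mem_gatherState_edges (t : ℕ) (v : V) (e : ℕ × ℕ) :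
    e ∈ (gatherState net k κ (t + 1) v).edges ↔ e ∈ (gatherState net k κ t v).edges ∨
      ∃ p, e = (net.id v, net.id (net.nbr v p)) ∨
        e ∈ (gatherState net k κ t (net.nbr v p)).edges := by
  simp [gatherState, gatherAlgorithm, gatherState_ident]

theorem gatherState_edges_subset (t : ℕ) (v : V) :
    ∀ e ∈ (gatherState net k κ t v).edges, (netGraph net).Adj e.1 e.2 := by
  induction t generalizing v with
  | zero => intro e he; exact he.elim
  | succ t ih =>
    intro e he
    rcases (mem_gatherState_edges net k κ t v e).1 he with he | ⟨p, rfl | he⟩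
    · exact ih v e he
    · exact (netGraph_adj_id net).2 (net.adj_nbr v p)
    · exact ih _ e he

theorem knownGraph_le (t : ℕ) (v : V) :
    knownGraph (gatherState net k κ t v).edges ≤ netGraph net := by
  intro a b hab
  rcases ((SimpleGraph.fromRel_adj _ _ _).1 hab).2 with h | h
  · exact gatherState_edges_subset net k κ t v _ h
  · exact (gatherState_edges_subset net k κ t v _ h).symm

theorem knownGraph_mono {S S' : Set (ℕ × ℕ)} (h : S ⊆ S') : knownGraph S ≤ knownGraph S' := by
  intro a b hab
  have hab := (SimpleGraph.fromRel_adj _ _ _).1 hab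
  exact (SimpleGraph.fromRel_adj _ _ _).2 ⟨hab.1, hab.2.imp (@h _) (@h _)⟩

/-- By monotonicity in `Agree.of_le`, what a neighbor knew one round earlier still counts after
merging, and all known edges are genuine. -/
theorem agree_knownGraph (t : ℕ) (v : V) :
    Agree (netGraph net) (knownGraph (gatherState net k κ t v).edges) t (net.id v) := by
  induction t generalizing v with
  | zero => trivial
  | succ t ih =>
    have hle := knownGraph_le net k κ (t + 1) v
    refine ⟨?_, fun a => ⟨fun ha => ?_, fun ha => hle ha⟩, fun a ha => ?_⟩
    · exact (ih v).of_le (knownGraph_mono fun e he =>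
        (mem_gatherState_edges net k κ t v e).2 (Or.inl he)) hle
    · obtain ⟨u, w, huw, hu, rfl⟩ := (netGraph_adj net).1 ha
      obtain rfl := net.id_injective hu
      obtain ⟨p, rfl⟩ := net.exists_nbr_eq huw
      exact (SimpleGraph.fromRel_adj _ _ _).2 ⟨ha.ne, Or.inl
        ((mem_gatherState_edges net k κ t u _).2 (Or.inr ⟨p, Or.inl rfl⟩))⟩
    · obtain ⟨u, w, huw, hu, rfl⟩ := (netGraph_adj net).1 ha
      obtain rfl := net.id_injective hu
      obtain ⟨p, rfl⟩ := net.exists_nbr_eq huw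
      exact (ih _).of_le (knownGraph_mono fun e he =>
        (mem_gatherState_edges net k κ t u e).2 (Or.inr ⟨p, Or.inr he⟩)) hle

variable {k κ}

/-- No node freezes early, since its clock differs from `roundCount` before the last round. -/
theorem state_gatherAlgorithm (hL : 0 < κ.logDegree) {t : ℕ} (ht : t ≤ roundCount k κ) (v : V) :
    (gatherAlgorithm k).state net κ t v = gatherState net k κ t v := by
  induction t generalizing v with
  | zero => rfl
  | succ t ih =>
    have ih := fun v => ih (by omega) v
    have hout : ((gatherAlgorithm k).output (G.degree v)
        ((gatherAlgorithm k).state net κ t v)).isSome = false := by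
      rw [ih]
      simp only [gatherAlgorithm, gatherState_know, gatherState_time]
      rw [if_neg (not_le.2 hL), if_neg (by omega)]
      rfl
    rw [ih] at hout
    simp only [LocalAlgorithm.state, ih, gatherState]
    exact if_neg (by simp [hout])

/-- A matching on the identifiers as a subgraph of the network. -/
def matchingSubgraph (M : ℕ → ℕ → Prop) (hM : ∀ a b, M a b → (netGraph net).Adj a b) :
    G.Subgraph where
  verts := {v | ∃ w, M (net.id v) (net.id w) ∨ M (net.id w) (net.id v)}
  Adj v w := M (net.id v) (net.id w) ∨ M (net.id w) (net.id v)
  adj_sub := fun h => h.elim (fun h => (netGraph_adj_id net).1 (hM _ _ h))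
    fun h => ((netGraph_adj_id net).1 (hM _ _ h)).symm
  edge_vert := fun h => ⟨_, h⟩
  symm := ⟨fun _ _ h => h.symm⟩

variable {net}

theorem isMatching_matchingSubgraph {M : ℕ → ℕ → Prop} (hM : ∀ a b, M a b → (netGraph net).Adj a b)
    (hd : DirMatching M) : (matchingSubgraph net M hM).IsMatching := by
  rintro v ⟨w, hw⟩
  refine ⟨w, hw, fun w' hw' => net.id_injective ?_⟩
  rcases hw with hw | hw <;> rcases hw' with hw' | hw'
  · exact (hd.disj hw' hw (by simp)).2
  · have := hd.disj hw' hw (by simp)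
    have := hd.lt hw
    omega
  · have := hd.disj hw' hw (by simp)
    have := hd.lt hw
    omega
  · exact (hd.disj hw' hw (by simp)).1

theorem describes_matchingSubgraph {M : ℕ → ℕ → Prop} (hM : ∀ a b, M a b → (netGraph net).Adj a b)
    (hd : DirMatching M) {out : ∀ v : V, MatchOutput (G.degree v)}
    (hsome : ∀ v p, out v = some p →
      M (net.id v) (net.id (net.nbr v p)) ∨ M (net.id (net.nbr v p)) (net.id v))
    (hnone : ∀ v, out v = none →
      ∀ p, ¬ (M (net.id v) (net.id (net.nbr v p)) ∨ M (net.id (net.nbr v p)) (net.id v))) :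
    net.Describes out (matchingSubgraph net M hM) := by
  intro v w
  constructor
  · intro h
    obtain ⟨p, rfl⟩ := net.exists_nbr_eq ((matchingSubgraph net M hM).adj_sub h)
    cases hout : out v with
    | none => exact (hnone v hout p h).elim
    | some q =>
      refine ⟨q, rfl, ?_⟩
      have hq : (matchingSubgraph net M hM).Adj v (net.nbr v q) := hsome v q hout
      exact ((isMatching_matchingSubgraph hM hd) ⟨_, h⟩).unique hq h
  · rintro ⟨p, hp, rfl⟩
    exact hsome v p hp

theorem ncard_edgeSet_eq {N : ℕ} (hN : ∀ v, net.id v < N) {K : G.Subgraph} {P : ℕ → ℕ → Prop}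
    (hP : ∀ a b, P a b ↔ a < b ∧ ∃ u v, net.id u = a ∧ net.id v = b ∧ K.Adj u v) :
    K.edgeSet.ncard = (relEdges N P).card := by
  rw [← Set.ncard_image_of_injective _ (Sym2.map.injective net.id_injective),
    ← Set.ncard_coe_finset,
    ← Set.InjOn.ncard_image (f := fun e : ℕ × ℕ => s(e.1, e.2)) (s := ↑(relEdges N P))]
  · congr 1
    ext e
    constructor
    · rintro ⟨e', he', rfl⟩
      induction e' with
      | _ u v =>
        have huv : K.Adj u v := he'
        have hne : net.id u ≠ net.id v := fun h => huv.adj_sub.ne (net.id_injective h)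
        rcases lt_or_gt_of_ne hne with h | h
        · exact ⟨(net.id u, net.id v), Finset.mem_coe.2 (mem_relEdges.2
            ⟨⟨hN u, hN v⟩, (hP _ _).2 ⟨h, u, v, rfl, rfl, huv⟩⟩), rfl⟩
        · exact ⟨(net.id v, net.id u), Finset.mem_coe.2 (mem_relEdges.2
            ⟨⟨hN v, hN u⟩, (hP _ _).2 ⟨h, v, u, rfl, rfl, huv.symm⟩⟩), Sym2.eq_swap⟩
    · rintro ⟨⟨a, b⟩, hab, rfl⟩
      obtain ⟨-, u, v, rfl, rfl, huv⟩ := (hP a b).1 (mem_relEdges.1 (Finset.mem_coe.1 hab)).2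
      exact ⟨s(u, v), huv, rfl⟩
  · rintro ⟨a, b⟩ he ⟨a', b'⟩ he' h
    have h1 := ((hP _ _).1 (mem_relEdges.1 (Finset.mem_coe.1 he)).2).1
    have h2 := ((hP _ _).1 (mem_relEdges.1 (Finset.mem_coe.1 he')).2).1
    simp only [Sym2.eq_iff] at h
    rcases h with ⟨rfl, rfl⟩ | ⟨rfl, rfl⟩
    · rfl
    · simp only at h1 h2; omega

theorem card_upSet_le {N h : ℕ} (hdeg : G.maxDegree ≤ 2 ^ h) {E : ℕ → ℕ → Prop}
    (hE : ∀ a b, E a b → (netGraph net).Adj a b) (a : ℕ) : (upSet N E a).card ≤ 2 ^ h := by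
  classical
  by_cases ha : ∃ u, net.id u = a
  · obtain ⟨u, rfl⟩ := ha
    calc _ ≤ ((G.neighborFinset u).image net.id).card := by
          refine Finset.card_le_card fun b hb => ?_
          obtain ⟨u', w, huw, hu, rfl⟩ :=
            (netGraph_adj net).1 (hE _ _ (Finset.mem_filter.1 hb).2)
          obtain rfl := net.id_injective hu
          exact Finset.mem_image_of_mem _ ((G.mem_neighborFinset _ _).2 huw)
      _ ≤ G.degree u := Finset.card_image_le
      _ ≤ G.maxDegree := G.degree_le_maxDegree u
      _ ≤ _ := hdeg
  · rw [Finset.card_eq_zero.2]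
    · exact Nat.zero_le _
    · refine Finset.eq_empty_of_forall_notMem fun b hb => ha ?_
      obtain ⟨u, _, _, hu, _⟩ := (netGraph_adj net).1 (hE _ _ (Finset.mem_filter.1 hb).2)
      exact ⟨u, hu⟩

theorem goodEdges_netGraph {N h : ℕ} (hN : ∀ v, net.id v < N) (hdeg : G.maxDegree ≤ 2 ^ h) :
    GoodEdges N h (edgeLabel N (upEdges (netGraph net)) (logStar (N : ℝ)))
      (upEdges (netGraph net)) := by
  refine goodEdges_edgeLabel (fun a b hab => ?_) (fun a b hab => hab.2)
    (card_upSet_le hdeg fun a b hab => hab.1) (card_upSet_le hdeg fun a b hab => hab.1.symm)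
  obtain ⟨u, v, _, rfl, rfl⟩ := (netGraph_adj net).1 hab.1
  exact ⟨hN u, hN v⟩

theorem dirMatching_of_isMatching {K : G.Subgraph} (hK : K.IsMatching) :
    DirMatching fun a b => a < b ∧ ∃ u v, net.id u = a ∧ net.id v = b ∧ K.Adj u v := by
  refine ⟨fun h => h.1, ?_⟩
  have huniq : ∀ {u v w}, K.Adj u v → K.Adj u w → v = w := fun h h' =>
    (hK (K.edge_vert h)).unique h h'
  rintro a b a' b' ⟨h1, u, v, rfl, rfl, huv⟩ ⟨h2, u', v', rfl, rfl, huv'⟩ h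
  rcases h with h | h | h | h <;> obtain rfl := net.id_injective h
  · rw [huniq huv huv']; simp
  · rw [huniq huv huv'.symm] at h1; omega
  · rw [huniq huv.symm huv'] at h1; omega
  · rw [huniq huv.symm huv'.symm]; simp

end Simulation

/-! ### Parameters, round count and conclusion -/

section Main

theorem iterCount_spec {ε : ℝ} (hε : 0 < ε) : (2 + ε) * (31 / 32 : ℝ) ^ iterCount ε ≤ ε := by
  set q := ⌈max 1 (Real.logb 2 (1 / ε))⌉₊ with hq
  have h1 : max 1 (Real.logb 2 (1 / ε)) ≤ q := Nat.le_ceil _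
  have h2 : (31 / 32 : ℝ) ^ iterCount ε ≤ (1 / 2) ^ (q + 2) := by
    rw [iterCount, pow_mul]
    -- Here `(31 / 32) ^ 22 ≤ 1 / 2` explains the factor `22`.
    exact pow_le_pow_left₀ (by norm_num) (by norm_num) _
  have h3 : (1 / 2 : ℝ) ^ q ≤ 1 / 2 := by
    have hq1 : 1 ≤ q := by exact_mod_cast (le_max_left _ _).trans h1
    calc (1 / 2 : ℝ) ^ q ≤ (1 / 2) ^ 1 := pow_le_pow_of_le_one (by norm_num) (by norm_num) hq1
      _ = 1 / 2 := pow_one _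
  have h4 : (1 / 2 : ℝ) ^ q ≤ ε := by
    have h5 := (le_max_right _ _).trans h1
    rw [Real.logb_le_iff_le_rpow (by norm_num) (by positivity), Real.rpow_natCast] at h5
    rw [one_div_pow]
    exact (one_div_le (by positivity) hε).2 h5
  have h6 : (31 / 32 : ℝ) ^ iterCount ε ≤ (1 / 2) ^ q / 4 := by
    refine h2.trans (le_of_eq ?_)
    rw [pow_add]; ring
  have h7 : (0 : ℝ) < 2 + ε := by linarith
  calc _ ≤ (2 + ε) * ((1 / 2) ^ q / 4) := mul_le_mul_of_nonneg_left h6 h7.le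
    -- With `(1 / 2) ^ q` at most `ε` and at most `1 / 2`, the product is at most `ε / 2 + ε / 8`.
    _ ≤ ε := by nlinarith

theorem iterCount_le (ε : ℝ) : (iterCount ε : ℝ) ≤ 88 * max 1 (Real.logb 2 (1 / ε)) := by
  have h1 : (1 : ℝ) ≤ max 1 (Real.logb 2 (1 / ε)) := le_max_left _ _
  have h2 := Nat.ceil_lt_add_one (show 0 ≤ max 1 (Real.logb 2 (1 / ε)) by linarith)
  unfold iterCount
  push_cast
  linarith

/-- The cost of an iteration is `4 * h ^ 2 + 4 * h + 11`. -/
theorem radius_le {N h s : ℕ} (hh : 1 ≤ h) :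
    radius N h s ≤ 1 + logStar (N : ℝ) + s * (19 * h ^ 2) := by
  obtain ⟨g, rfl⟩ := Nat.exists_eq_add_of_le' hh
  unfold radius
  refine Nat.add_le_add_left (Nat.mul_le_mul_left _ ?_) _
  rw [show 4 * (g + 1) - 1 + 2 = 4 * g + 5 by omega]
  nlinarith

theorem degreeBits_le {k L ℓ : ℝ} (hk : 1 ≤ k) (hL : 0 < L) (hℓ : 1 ≤ ℓ) (h : L ≤ k * ℓ) :
    (degreeBits k L : ℝ) ≤ 2 * k ^ 2 * ℓ := by
  have h1 := Nat.ceil_lt_add_one (show 0 ≤ k * L by positivity)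
  have h2 : k * L ≤ k * (k * ℓ) := mul_le_mul_of_nonneg_left h (by linarith)
  have h3 : 1 ≤ k ^ 2 * ℓ := one_le_mul_of_one_le_of_one_le (one_le_pow₀ hk) hℓ
  unfold degreeBits
  nlinarith

theorem maxDegree_le_two_pow {d : ℕ} {k L : ℝ} (h : Real.logb 2 (d : ℝ) ≤ k * L) :
    d ≤ 2 ^ degreeBits k L := by
  rcases Nat.eq_zero_or_pos d with rfl | hd
  · exact Nat.zero_le _
  · have h1 : Real.logb 2 (d : ℝ) ≤ degreeBits k L := h.trans (Nat.le_ceil _)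
    rw [Real.logb_le_iff_le_rpow (by norm_num) (by exact_mod_cast hd), Real.rpow_natCast] at h1
    exact_mod_cast h1

variable {V : Type*} [Fintype V] {G : SimpleGraph V} [DecidableRel G.Adj] {net : Network G}

/-- Here the whole edge set is a matching. The case is separate because the term with `log Δ` in the
round bound vanishes. -/
theorem isApproxMaximumMatching_of_maxDegree_le_one (hdeg : G.maxDegree ≤ 1) {c : ℝ} (hc : 1 ≤ c) :
    ∃ M : G.Subgraph, net.Describes
      (fun v => if h : 0 < G.degree v then some ⟨0, h⟩ else none) M ∧
        IsApproxMaximumMatching c M := by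
  classical
  have huniq : ∀ {v w w'}, G.Adj v w → G.Adj v w' → w = w' := by
    intro v w w' h h'
    exact Finset.card_le_one.1 ((G.degree_le_maxDegree v).trans hdeg) w
      ((G.mem_neighborFinset _ _).2 h) w' ((G.mem_neighborFinset _ _).2 h')
  refine ⟨{ verts := {v | ∃ w, G.Adj v w}, Adj := G.Adj, adj_sub := id,
            edge_vert := fun h => ⟨_, h⟩, symm := G.symm }, ?_, ?_, ?_⟩
  · intro v w
    constructor
    · intro h
      have hpos : 0 < G.degree v := (G.degree_pos_iff_exists_adj v).2 ⟨w, h⟩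
      exact ⟨⟨0, hpos⟩, dif_pos hpos, huniq (net.adj_nbr v _) h⟩
    · rintro ⟨p, -, rfl⟩
      exact net.adj_nbr v p
  · rintro v ⟨w, hw⟩
    exact ⟨w, hw, fun w' hw' => huniq hw' hw⟩
  · intro Mstar _
    have h1 : Mstar.edgeSet.ncard ≤ G.edgeSet.ncard :=
      Set.ncard_le_ncard (SimpleGraph.Subgraph.edgeSet_subset _) (Set.toFinite _)
    have h2 : (Mstar.edgeSet.ncard : ℝ) ≤ G.edgeSet.ncard := by exact_mod_cast h1
    exact h2.trans (le_mul_of_one_le_left (Nat.cast_nonneg _) hc)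

theorem isApproxMaximumMatching_graphMatching {N h s : ℕ} (hN : ∀ v, net.id v < N) (hh : 1 ≤ h)
    (hdeg : G.maxDegree ≤ 2 ^ h) {ε : ℝ} (hε : 0 < ε) (hs : (2 + ε) * (31 / 32 : ℝ) ^ s ≤ ε) :
    ∃ hM : ∀ a b, graphMatching N h s (netGraph net) a b → (netGraph net).Adj a b,
      DirMatching (graphMatching N h s (netGraph net)) ∧
      IsApproxMaximumMatching (2 + ε) (matchingSubgraph net _ hM) := by
  have hE := goodEdges_netGraph hN hdeg
  have hspec := hE.iterMatching_spec (m := h + 5) s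
  have hM : ∀ a b, graphMatching N h s (netGraph net) a b → (netGraph net).Adj a b :=
    fun a b hab => (hspec.2 a b hab).1
  have hd : DirMatching (graphMatching N h s (netGraph net)) := hspec.1
  refine ⟨hM, hd, isMatching_matchingSubgraph hM hd, fun Mstar hstar => ?_⟩
  rw [ncard_edgeSet_eq hN (K := Mstar) fun a b => Iff.rfl,
    ncard_edgeSet_eq hN (K := matchingSubgraph net _ hM)
      (P := graphMatching N h s (netGraph net)) fun a b => ?_]
  · refine hE.card_le_iterMatching hh (by omega)
      (edgeLabel_lt (card_upSet_le hdeg fun a b hab => hab.1)) hε hs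
      (dirMatching_of_isMatching hstar.1) ?_
    rintro a b ⟨hlt, u, v, rfl, rfl, huv⟩
    exact ⟨(netGraph_adj_id net).2 huv.adj_sub, hlt⟩
  · constructor
    · intro hab
      obtain ⟨u, v, -, rfl, rfl⟩ := (netGraph_adj net).1 (hM a b hab)
      exact ⟨hd.lt hab, u, v, rfl, rfl, Or.inl hab⟩
    · rintro ⟨hlt, u, v, rfl, rfl, huv | huv⟩
      · exact huv
      · have := hd.lt huv
        omega

/-- Each node computes its part of the matching of the whole network from the graph that it
knows. -/
theorem knownMatching_iff {k : ℝ} {κ : Knowledge} (v : V) (b : ℕ) :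
    (knownMatching k κ (knownGraph (gatherState net k κ (roundCount k κ) v).edges) (net.id v) b ↔
      knownMatching k κ (netGraph net) (net.id v) b) ∧
    (knownMatching k κ (knownGraph (gatherState net k κ (roundCount k κ) v).edges) b (net.id v) ↔
      knownMatching k κ (netGraph net) b (net.id v)) := by
  have h := edgeAgree_graphMatching κ.idBound (degreeBits k κ.logDegree) (iterCount κ.eps)
    (net.id v) (agree_knownGraph net k κ (roundCount k κ) v) b
  exact ⟨(iff_of_eq h.1).symm, (iff_of_eq h.2).symm⟩

theorem exists_out_of_logDegree_pos {k : ℝ} {κ : Knowledge} (hL : 0 < κ.logDegree)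
    (hM : ∀ a b, knownMatching k κ (netGraph net) a b → (netGraph net).Adj a b)
    (hd : DirMatching (knownMatching k κ (netGraph net))) :
    ∃ out : ∀ v : V, MatchOutput (G.degree v),
      (gatherAlgorithm k).TerminatesWithin net κ (roundCount k κ) out ∧
        net.Describes out (matchingSubgraph net _ hM) := by
  classical
  set R := roundCount k κ with hR
  -- At least one round is needed for a node to learn the names of its neighbors.
  obtain ⟨R', hR'⟩ : ∃ R', R = R' + 1 :=
    Nat.exists_eq_succ_of_ne_zero (by rw [hR, roundCount, radius]; omega)
  have hnames : ∀ v (p : Fin (G.degree v)),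
      (gatherState net k κ R v).names p = net.id (net.nbr v p) := fun v p => by
    rw [hR']; exact gatherState_names net k κ R' v p
  have hiff : ∀ v (p : Fin (G.degree v)),
      (knownMatching k κ (knownGraph (gatherState net k κ R v).edges)
          (gatherState net k κ R v).ident ((gatherState net k κ R v).names p) ∨
        knownMatching k κ (knownGraph (gatherState net k κ R v).edges)
          ((gatherState net k κ R v).names p) (gatherState net k κ R v).ident) ↔
      (knownMatching k κ (netGraph net) (net.id v) (net.id (net.nbr v p)) ∨
        knownMatching k κ (netGraph net) (net.id (net.nbr v p)) (net.id v)) := by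
    intro v p
    rw [hnames, gatherState_ident, (knownMatching_iff v _).1, (knownMatching_iff v _).2]
  let out : ∀ v : V, MatchOutput (G.degree v) := fun v =>
    if h : ∃ p : Fin (G.degree v),
          knownMatching k κ (knownGraph (gatherState net k κ R v).edges)
            (gatherState net k κ R v).ident ((gatherState net k κ R v).names p) ∨
          knownMatching k κ (knownGraph (gatherState net k κ R v).edges)
            ((gatherState net k κ R v).names p) (gatherState net k κ R v).ident
        then some h.choose else none
  refine ⟨out, fun v => ?_, describes_matchingSubgraph hM hd (fun v p hp => ?_) fun v hv p hp => ?_⟩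
  · rw [state_gatherAlgorithm net hL le_rfl]
    simp only [gatherAlgorithm]
    rw [if_neg (by rw [gatherState_know]; exact not_le.2 hL),
      if_pos (by rw [gatherState_know, gatherState_time])]
    simp only [gatherState_know]
    rfl
  · simp only [out] at hp
    split_ifs at hp with h
    cases hp
    exact (hiff v _).1 h.choose_spec
  · simp only [out] at hv
    split_ifs at hv with h
    exact h ⟨p, (hiff v p).2 hp⟩

end Main

theorem theorem1 (c : ℕ) (k : ℝ) (hk : 1 ≤ k) :
    ∃ (A : LocalAlgorithm Knowledge MatchOutput) (C : ℝ),
      ∀ (ε : ℝ), 0 < ε →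
      ∀ (V : Type*) [Fintype V] (G : SimpleGraph V) [DecidableRel G.Adj] (net : Network G)
        (N : ℕ) (L : ℝ),
        (∀ v : V, net.id v < N) → N ≤ Fintype.card V ^ c →
        Real.logb 2 (G.maxDegree : ℝ) ≤ k * L → L ≤ k * Real.logb 2 (G.maxDegree : ℝ) →
        ∃ (T : ℕ) (out : ∀ v : V, MatchOutput (G.degree v)) (M : G.Subgraph),
          (T : ℝ) ≤ C * (Real.logb 2 (G.maxDegree : ℝ) ^ 2 * max 1 (Real.logb 2 (1 / ε))
            + (logStar (Fintype.card V : ℝ) : ℝ)) ∧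
          A.TerminatesWithin net ⟨N, L, ε⟩ T out ∧
          net.Describes out M ∧
          IsApproxMaximumMatching (2 + ε) M := by
  set K := logStar (2 * (c + 1 : ℕ) : ℝ) with hK
  -- `6688 = 88 * 19 * 2 ^ 2`, from `iterCount_le`, `radius_le` and `degreeBits_le`. The additive `K
  -- + 1` is absorbed since `ℓ ^ 2 * μ ≥ 1` once `Δ ≥ 2`.
  refine ⟨gatherAlgorithm k, 6688 * k ^ 4 + K + 1, ?_⟩
  intro ε hε V _ G _ net N L hN hNc hL1 hL2
  set μ := max 1 (Real.logb 2 (1 / ε)) with hμ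
  have hμ1 : 1 ≤ μ := le_max_left _ _
  set ℓ := Real.logb 2 (G.maxDegree : ℝ) with hℓ
  have hk4 : 0 ≤ k ^ 4 := by positivity
  -- The sign of `L` tells the nodes whether `Δ ≤ 1`.
  rcases le_or_gt L 0 with hL | hL
  · have hdeg : G.maxDegree ≤ 1 := by
      by_contra hcon
      have h1 : (1 : ℝ) < G.maxDegree := by exact_mod_cast not_le.1 hcon
      have h2 : 0 < ℓ := Real.logb_pos (by norm_num) h1
      have h3 : k * L ≤ 0 := mul_nonpos_of_nonneg_of_nonpos (by linarith) hL
      linarith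
    obtain ⟨M, hM1, hM2⟩ := isApproxMaximumMatching_of_maxDegree_le_one (net := net) hdeg
      (show 1 ≤ 2 + ε by linarith)
    refine ⟨0, _, M, ?_, fun v => ?_, hM1, hM2⟩
    · push_cast; positivity
    · exact if_pos hL
  · have hℓ0 : 0 < ℓ := by
      by_contra hcon
      have h3 : k * ℓ ≤ 0 := mul_nonpos_of_nonneg_of_nonpos (by linarith) (not_lt.1 hcon)
      linarith
    have hℓ1 : 1 ≤ ℓ := by
      have h1 : 2 ≤ G.maxDegree := by
        by_contra hcon
        have : G.maxDegree = 0 ∨ G.maxDegree = 1 := by omega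
        rcases this with h | h <;> simp [hℓ, h] at hℓ0
      rw [hℓ, Real.le_logb_iff_rpow_le (by norm_num) (by positivity), Real.rpow_one]
      exact_mod_cast h1
    have hh : 1 ≤ degreeBits k L := Nat.one_le_ceil_iff.2 (by positivity)
    obtain ⟨hM, hd, happ⟩ := isApproxMaximumMatching_graphMatching hN hh
      (maxDegree_le_two_pow hL1) hε (iterCount_spec hε)
    obtain ⟨out, ho1, ho2⟩ := exists_out_of_logDegree_pos (k := k) (κ := ⟨N, L, ε⟩) hL hM hd
    refine ⟨_, out, _, ?_, ho1, ho2, happ⟩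
    have h1 : roundCount k ⟨N, L, ε⟩ ≤
        1 + logStar (N : ℝ) + iterCount ε * (19 * degreeBits k L ^ 2) := radius_le hh
    have h2 := logStar_le_of_le_pow c hNc
    rw [← hK] at h2
    have h3 : (roundCount k ⟨N, L, ε⟩ : ℝ) ≤ 1 + (logStar (Fintype.card V : ℝ) + K) +
        iterCount ε * (19 * degreeBits k L ^ 2) := by
      exact_mod_cast h1.trans (by omega)
    have h4 : (iterCount ε : ℝ) * (19 * degreeBits k L ^ 2) ≤
        88 * μ * (19 * (2 * k ^ 2 * ℓ) ^ 2) := by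
      have h5 := degreeBits_le hk hL hℓ1 hL2
      have h6 := iterCount_le ε
      gcongr
    have h5 : 1 ≤ ℓ ^ 2 * μ := one_le_mul_of_one_le_of_one_le (one_le_pow₀ hℓ1) hμ1
    have h6 : (0 : ℝ) ≤ logStar (Fintype.card V : ℝ) := Nat.cast_nonneg _
    have h7 : (0 : ℝ) ≤ K := Nat.cast_nonneg _
    have h8 : (1 + K : ℝ) ≤ (1 + K) * (ℓ ^ 2 * μ) := le_mul_of_one_le_right (by linarith) h5
    have h9 : (logStar (Fintype.card V : ℝ) : ℝ) ≤
        (6688 * k ^ 4 + K + 1) * logStar (Fintype.card V : ℝ) :=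
      le_mul_of_one_le_left h6 (by linarith)
    calc (roundCount k ⟨N, L, ε⟩ : ℝ) ≤ 1 + (logStar (Fintype.card V : ℝ) + K) +
          88 * μ * (19 * (2 * k ^ 2 * ℓ) ^ 2) := by linarith
      _ = (1 + K) + 6688 * k ^ 4 * (ℓ ^ 2 * μ) + logStar (Fintype.card V : ℝ) := by ring
      _ ≤ _ := by linarith
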